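/- Let $k,l\ge 0$ be integers and $n=k+l$ (the geometric situation is $k\ge1$, $l\ge2$). Write $\mathbb R^n=\mathbb R^k\oplus\mathbb R^l$ with coordinates $(x,y)$, and let $u(t)=\|u_{ij}(t)\|$ be a real $l\times k$ matrix whose entries are polynomials in $t\in\mathbb R^k$. It defines the family $K$ of $k$-planes $y=u(t)x+\alpha$, $\alpha\in\mathbb R^l$, $t\in\mathbb R^k$. The Crofton function $\mathrm{Cr}_K(\eta,\xi)$, $(\eta,\xi)\in\mathbb R^k\oplus\mathbb R^l$, is the number of solutions $t\in\mathbb R^k$ of $\eta=-\xi u(t)$ ($\xi$ being a row vector), and $\omega(\xi,t)=\det\bigl(\partial(\xi u(t))/\partial t\bigr)$. Let $a(s,t)$ be a tempered generalized function on $\mathbb R^l\times\mathbb R^k$. For a Schwartz function $f$ on $\mathbb R^n$ let $\varphi=J_af$ be the tempered generalized function $$\varphi(\alpha,t)=\int f(x,y)\,a(y-u(t)x-\alpha,t)\,dx\,dy ,$$ that is, $\langle\varphi,\psi\rangle=\bigl\langle a(s,t),\ \int f(x,y)\,\psi(y-u(t)x-s,t)\,dx\,dy\bigr\rangle$ for Schwartz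 functions $\psi$. Assume that $\mathrm{Cr}_K$ is finite and nonzero almost everywhere, and that the partial Fourier transform $\tilde a(\xi,t)=\int a(s,t)e^{i\langle s,\xi\rangle}ds$ is an ordinary (locally integrable) function that is nonzero almost everywhere. Then for every Schwartz function $f$ and all $(x,y)$, $$f(x,y)=\int \varphi(\alpha,t)\,A(y-u(t)x-\alpha,t)\,d\alpha\,dt,\qquad A(s,t)=\int b(\xi,t)\,e^{i\langle s,\xi\rangle}\,d\xi ,$$ $$b(\xi,t)=\frac{1}{(2\pi)^{n}}\,\frac{|\omega(\xi,t)|}{\mathrm{Cr}_K(-\xi u(t),\xi)\,\tilde a(\xi,t)} .$$ Here $A$ is in general given by a divergent Fourier integral, and the formula is understood in the sense of generalized functions, the integration over $\alpha$ being carried out first: the partial Fourier transform $\tilde\varphi(\xi,t)=\int\varphi(\alpha,t)e^{i\langle\alpha,\xi\rangle}d\alpha$ is an ordinary (locally integrable) function, the function $b(\xi,t)\,\tilde\varphi(-\xi,t)$ is Lebesgue integrable over $\mathbb R^l\times\mathbb R^k$, and $$f(x,y)=\int_{\mathbb R^l\times\mathbb R^k} b(\xi,t)\,\tilde\varphi(-\xi,t)\,e^{i\langle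 y-u(t)x,\xi\rangle}\,d\xi\,dt .$$ If moreover $\varphi$ is an ordinary function that is integrable over $\mathbb R^l\times C$ for every compact $C\subset\mathbb R^k$, and $b(\cdot,t)$ is integrable for almost every $t$, then the formula for $f$ holds literally, as the iterated integral over $\alpha$ and then $t$, with $A$ given by an absolutely convergent integral. -/

import Mathlib

open MeasureTheory
open scoped SchwartzMap ContDiff Matrix
noncomputable section

namespace PlaneComplex

section PartialFourier

set_option linter.unusedSectionVars false

variable {l : ℕ} {T G : Type} [NormedAddCommGroup T] [NormedSpace ℝ T]
  [NormedAddCommGroup G] [NormedSpace ℝ G] [NormedSpace ℂ G] [SMulCommClass ℝ ℂ G]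
  [IsScalarTower ℝ ℂ G]

/-- The character `e^{i⟨s, ξ⟩}`. -/
def chr (s ξ : Fin l → ℝ) : ℂ := Complex.exp (Complex.I * (s ⬝ᵥ ξ : ℝ))

lemma norm_chr (s ξ : Fin l → ℝ) : ‖chr s ξ‖ = 1 := by
  rw [chr, mul_comm]; exact Complex.norm_exp_ofReal_mul_I _

lemma continuous_chr : Continuous (fun p : (Fin l → ℝ) × (Fin l → ℝ) => chr p.1 p.2) := by
  unfold chr dotProduct; fun_prop

/-- The integral `∫ e^{i⟨s, ξ⟩} H(ξ, t) dξ` as a function of `(s, t)`. -/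
def pint (H : (Fin l → ℝ) × T → G) (z : (Fin l → ℝ) × T) : G :=
  ∫ ξ : Fin l → ℝ, chr z.1 ξ • H (ξ, z.2)

lemma slice_bound (k : ℕ) : ∃ p : Seminorm ℝ 𝓢((Fin l → ℝ) × T, G),
    Continuous p ∧ ∀ (H : 𝓢((Fin l → ℝ) × T, G)) (ξ : Fin l → ℝ) (t : T),
      ‖t‖ ^ k * ‖H (ξ, t)‖ ≤
        p H * (1 + ‖ξ‖) ^ (-((volume : Measure (Fin l → ℝ)).integrablePower : ℝ)) := by
  set m := (volume : Measure (Fin l → ℝ)).integrablePower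
  refine ⟨((2 : NNReal) ^ (k + m)) • ∑ i ∈ Finset.Iic (k + m, 0),
      schwartzSeminormFamily ℝ ((Fin l → ℝ) × T) G i, ?_, ?_⟩
  · have h : Continuous fun H : 𝓢((Fin l → ℝ) × T, G) => ((2 : NNReal) ^ (k + m)) •
        ∑ i ∈ Finset.Iic (k + m, 0), schwartzSeminormFamily ℝ ((Fin l → ℝ) × T) G i H :=
      (continuous_finsetSum _ fun i _ =>
        (schwartz_withSeminorms ℝ _ _).continuous_seminorm i).const_smul _
    convert h using 2 with H
    simp only [smul_apply, sum_apply]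
  · intro H ξ t
    have h := SchwartzMap.one_add_le_sup_seminorm_apply (𝕜 := ℝ) (m := (k + m, 0)) (k := k + m)
      (n := 0) le_rfl le_rfl H (ξ, t)
    rw [norm_iteratedFDeriv_zero] at h
    rw [Real.rpow_neg (by positivity), Real.rpow_natCast, ← div_eq_mul_inv,
      le_div_iff₀ (by positivity)]
    refine le_trans ?_ (h.trans ?_)
    swap
    · refine mul_le_mul_of_nonneg_left
        (Seminorm.finset_sup_le_sum (schwartzSeminormFamily ℝ ((Fin l → ℝ) × T) G) _ H)
        (by positivity)
    have h1 : ‖t‖ ≤ 1 + ‖(ξ, t)‖ := (norm_snd_le (ξ, t)).trans (by linarith)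
    have h2 : 1 + ‖ξ‖ ≤ 1 + ‖(ξ, t)‖ := by linarith [norm_fst_le (ξ, t)]
    rw [pow_add]
    calc ‖t‖ ^ k * ‖H (ξ, t)‖ * (1 + ‖ξ‖) ^ m = ‖t‖ ^ k * (1 + ‖ξ‖) ^ m * ‖H (ξ, t)‖ := by ring
      _ ≤ _ := by gcongr

lemma slice_integrable (H : 𝓢((Fin l → ℝ) × T, G)) (s : Fin l → ℝ) (t : T) :
    Integrable (fun ξ : Fin l → ℝ => chr s ξ • H (ξ, t)) := by
  obtain ⟨p, -, hp⟩ := slice_bound (l := l) (T := T) (G := G) 0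
  refine ((Measure.integrable_pow_neg_integrablePower volume).const_mul (p H)).mono' ?_ ?_
  · exact ((continuous_chr.comp (by fun_prop : Continuous fun ξ => (s, ξ))).smul
      (H.continuous.comp (by fun_prop))).aestronglyMeasurable
  · filter_upwards with ξ
    simpa [norm_smul, norm_chr] using hp H ξ t

lemma pint_bound (k : ℕ) : ∃ p : Seminorm ℝ 𝓢((Fin l → ℝ) × T, G),
    Continuous p ∧ ∀ (H : 𝓢((Fin l → ℝ) × T, G)) (z : (Fin l → ℝ) × T),
      ‖z.2‖ ^ k * ‖pint H z‖ ≤ p H := by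
  obtain ⟨p, hpc, hp⟩ := slice_bound (l := l) (T := T) (G := G) k
  set I := ∫ ξ : Fin l → ℝ, (1 + ‖ξ‖) ^ (-((volume : Measure (Fin l → ℝ)).integrablePower : ℝ))
  have hI : 0 ≤ I := integral_nonneg fun _ => by positivity
  refine ⟨I.toNNReal • p, hpc.const_smul I.toNNReal, fun H z => ?_⟩
  have : ‖z.2‖ ^ k * ‖pint H z‖ ≤ ∫ ξ : Fin l → ℝ, p H * (1 + ‖ξ‖) ^
      (-((volume : Measure (Fin l → ℝ)).integrablePower : ℝ)) := by
    rw [← Real.norm_of_nonneg (by positivity : (0:ℝ) ≤ ‖z.2‖ ^ k), ← norm_smul, pint,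
      ← integral_smul]
    refine norm_integral_le_of_norm_le
      ((Measure.integrable_pow_neg_integrablePower volume).const_mul (p H)) ?_
    filter_upwards with ξ
    simpa [norm_smul, norm_chr] using hp H ξ z.2
  refine this.trans (le_of_eq ?_)
  rw [integral_const_mul, mul_comm, smul_apply, NNReal.smul_def, Real.coe_toNNReal _ hI]; rfl

/-- Differentiation in the direction `ξ_j`, multiplied by `i`. -/
def iD (j : Fin l) : 𝓢((Fin l → ℝ) × T, G) →L[ℝ] 𝓢((Fin l → ℝ) × T, G) :=
  (SchwartzMap.postcompCLM (𝕜 := ℝ) (Complex.I • ContinuousLinearMap.id ℝ G)).comp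
    ((SchwartzMap.evalCLM ℝ _ G (Pi.single j (1 : ℝ), (0 : T))).comp
      (SchwartzMap.fderivCLM ℝ _ G))

lemma iD_apply (j : Fin l) (H : 𝓢((Fin l → ℝ) × T, G)) (z) :
    iD j H z = Complex.I • fderiv ℝ H z (Pi.single j 1, 0) := rfl

lemma hasFDerivAt_chr (s ξ : Fin l → ℝ) : HasFDerivAt (fun w => chr s w)
    ((chr s ξ * Complex.I) • (Complex.ofRealCLM.comp
      (∑ j, s j • ContinuousLinearMap.proj (R := ℝ) (φ := fun _ : Fin l => ℝ) j))) ξ := by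
  have h : HasFDerivAt (fun w : Fin l → ℝ => s ⬝ᵥ w)
      (∑ j, s j • ContinuousLinearMap.proj (R := ℝ) (φ := fun _ : Fin l => ℝ) j) ξ := by
    unfold dotProduct
    exact HasFDerivAt.fun_sum fun j _ => (hasFDerivAt_apply j ξ).const_mul (s j)
  have h2 := ((Complex.ofRealCLM.hasFDerivAt.comp ξ h).const_mul Complex.I).cexp
  refine h2.congr_fderiv ?_
  ext v
  simp [chr, mul_assoc]

lemma chr_comm (s ξ : Fin l → ℝ) : chr s ξ = chr ξ s := by rw [chr, chr, dotProduct_comm]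

lemma pint_iD (j : Fin l) (H : 𝓢((Fin l → ℝ) × T, G)) (z : (Fin l → ℝ) × T) :
    pint (iD j H) z = z.1 j • pint H z := by
  obtain ⟨s, t⟩ := z
  have hd : ∀ ξ : Fin l → ℝ, HasFDerivAt (fun ξ => H (ξ, t))
      ((fderiv ℝ H (ξ, t)).comp (ContinuousLinearMap.inl ℝ _ _)) ξ := fun ξ =>
    (H.differentiableAt.hasFDerivAt (x := (ξ, t))).comp ξ (hasFDerivAt_prodMk_left ξ t)
  have hc : ∀ ξ : Fin l → ℝ, fderiv ℝ (fun w => chr s w) ξ (Pi.single j 1)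
      = (Complex.I * s j) * chr s ξ := fun ξ => by
    rw [(hasFDerivAt_chr s ξ).fderiv]
    simp [Pi.single_apply]; ring
  have key := integral_smul_fderiv_eq_neg_fderiv_smul_of_integrable
    (μ := (volume : Measure (Fin l → ℝ))) (𝕜 := ℂ)
    (f := fun w => chr s w) (g := fun ξ => H (ξ, t)) (v := Pi.single j 1) ?_ ?_ ?_
    (fun x _ => (hasFDerivAt_chr s x).differentiableAt) (fun x _ => (hd x).differentiableAt)
  · simp only [hc, mul_smul] at key
    simp only [pint, iD_apply]
    have e : ∀ ξ : Fin l → ℝ, chr s ξ • Complex.I • fderiv ℝ H (ξ, t) (Pi.single j 1, 0) =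
        Complex.I • chr s ξ • fderiv ℝ (fun ξ => H (ξ, t)) ξ (Pi.single j 1) := fun ξ => by
      rw [(hd ξ).fderiv, smul_comm]; rfl
    simp only [e]
    rw [integral_smul, key, integral_smul, integral_smul, smul_neg, ← mul_smul, Complex.I_mul_I,
      neg_smul, neg_neg, one_smul]
    exact algebraMap_smul ℂ (s j) (∫ ξ : Fin l → ℝ, chr s ξ • H (ξ, t))
  · simp only [hc, mul_smul]
    exact ((slice_integrable H s t).smul (s j : ℂ)).smul Complex.I
  · have := (slice_integrable (iD j H) s t).smul (-Complex.I)
    refine this.congr (Filter.Eventually.of_forall fun ξ => ?_)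
    simp only [iD_apply, Pi.smul_apply]
    rw [(hd ξ).fderiv, smul_comm (chr s ξ), ← mul_smul]
    simp
  · exact slice_integrable H s t

lemma pint_iD_pow (k : ℕ) (j : Fin l) (H : 𝓢((Fin l → ℝ) × T, G)) (z : (Fin l → ℝ) × T) :
    pint ((iD j ^ k) H) z = z.1 j ^ k • pint H z := by
  induction k with
  | zero => simp
  | succ k ih =>
    rw [pow_succ', mul_apply_eq_comp, pint_iD, ih, ← mul_smul, pow_succ']

lemma pint_decay (k : ℕ) : ∃ p : Seminorm ℝ 𝓢((Fin l → ℝ) × T, G),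
    Continuous p ∧ ∀ (H : 𝓢((Fin l → ℝ) × T, G)) (z : (Fin l → ℝ) × T),
      ‖z‖ ^ k * ‖pint H z‖ ≤ p H := by
  obtain ⟨p, hpc, hp⟩ := pint_bound (l := l) (T := T) (G := G) k
  obtain ⟨q, hqc, hq⟩ := pint_bound (l := l) (T := T) (G := G) 0
  refine ⟨p + (q + ∑ j : Fin l, q.comp (iD (T := T) (G := G) j ^ k).toLinearMap), ?_, fun H z => ?_⟩
  · have : ∀ j : Fin l, Continuous fun H : 𝓢((Fin l → ℝ) × T, G) => q ((iD j ^ k) H) :=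
      fun j => hqc.comp (iD j ^ k).continuous
    have h2 : Continuous fun H : 𝓢((Fin l → ℝ) × T, G) =>
      p H + (q H + ∑ j : Fin l, q ((iD j ^ k) H)) := by fun_prop
    convert h2 using 2 with H
    simp only [add_apply, sum_apply]; rfl
  · have hs : ‖z.1‖ ^ k * ‖pint H z‖ ≤ q H + ∑ j : Fin l, q ((iD j ^ k) H) := by
      have hnn : ∀ j ∈ Finset.univ, 0 ≤ q ((iD (T := T) (G := G) j ^ k) H) :=
        fun j _ => apply_nonneg _ _
      by_cases hl : Nonempty (Fin l)
      · obtain ⟨j, -, hj⟩ := Finset.exists_mem_eq_sup' (Finset.univ_nonempty (α := Fin l))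
          (fun j => ‖z.1 j‖)
        have hn : ‖z.1‖ = ‖z.1 j‖ := by
          refine le_antisymm ((pi_norm_le_iff_of_nonneg (norm_nonneg _)).2 fun i => ?_)
            (norm_le_pi_norm _ _)
          rw [← hj]; exact Finset.le_sup' (fun j => ‖z.1 j‖) (Finset.mem_univ i)
        rw [hn, ← norm_pow, ← norm_smul, ← pint_iD_pow]
        have := hq ((iD j ^ k) H) z
        simp only [pow_zero, one_mul] at this
        refine this.trans ((Finset.single_le_sum hnn (Finset.mem_univ j)).trans ?_)
        linarith [apply_nonneg q H]
      · have : IsEmpty (Fin l) := not_nonempty_iff.1 hl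
        have h0 : ‖z.1‖ = 0 := by rw [Subsingleton.elim z.1 0, norm_zero]
        have := hq H z
        simp only [pow_zero, one_mul] at this
        have h1 : ‖z.1‖ ^ k ≤ 1 := by rw [h0]; exact pow_le_one₀ le_rfl zero_le_one
        have := Finset.sum_nonneg hnn
        nlinarith [norm_nonneg (pint H z), apply_nonneg q H]
    have ht := hp H z
    have hz : ‖z‖ ^ k ≤ ‖z.1‖ ^ k + ‖z.2‖ ^ k := by
      rw [Prod.norm_def]
      rcases max_choice ‖z.1‖ ‖z.2‖ with h | h <;> rw [h] <;>
        linarith [pow_nonneg (norm_nonneg z.1) k, pow_nonneg (norm_nonneg z.2) k]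
    have : (p + (q + ∑ j : Fin l, q.comp (iD (T := T) (G := G) j ^ k).toLinearMap)) H =
      p H + (q H + ∑ j : Fin l, q ((iD j ^ k) H)) := by
      simp only [add_apply, sum_apply]; rfl
    rw [this]
    nlinarith [norm_nonneg (pint H z)]

/-- The functional `v ↦ ⟨v.1, ξ⟩`, as a function of `(ξ, t)`. -/
def dualDot (z : (Fin l → ℝ) × T) : StrongDual ℝ ((Fin l → ℝ) × T) :=
  ∑ j, z.1 j • (ContinuousLinearMap.proj (R := ℝ) (φ := fun _ : Fin l => ℝ) j).comp
    (ContinuousLinearMap.fst ℝ _ _)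

lemma dualDot_apply (z v : (Fin l → ℝ) × T) : dualDot z v = v.1 ⬝ᵥ z.1 := by
  simp [dualDot, dotProduct, mul_comm]

lemma hasTemperateGrowth_dualDot :
    (dualDot : (Fin l → ℝ) × T → _).HasTemperateGrowth := by
  unfold dualDot
  refine Function.HasTemperateGrowth.sum fun j _ => ?_
  exact (((ContinuousLinearMap.proj (R := ℝ) (φ := fun _ : Fin l => ℝ) j).comp
    (ContinuousLinearMap.fst ℝ (Fin l → ℝ) T)).hasTemperateGrowth).smul (.const _)

/-- The integrand of the derivative of `pint`. -/
def dint : 𝓢((Fin l → ℝ) × T, G) →L[ℝ] 𝓢((Fin l → ℝ) × T, ((Fin l → ℝ) × T) →L[ℝ] G) :=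
  (SchwartzMap.postcompCLM (𝕜 := ℝ) (ContinuousLinearMap.precomp G
      ((ContinuousLinearMap.inr ℝ (Fin l → ℝ) T).comp (ContinuousLinearMap.snd ℝ _ _)))).comp
    (SchwartzMap.fderivCLM ℝ _ G) +
  (SchwartzMap.postcompCLM (𝕜 := ℝ) (Complex.I • ContinuousLinearMap.id ℝ _)).comp
    (SchwartzMap.bilinLeftCLM (𝕜 := ℝ)
      (ContinuousLinearMap.smulRightL ℝ ((Fin l → ℝ) × T) G).flip hasTemperateGrowth_dualDot)

lemma dint_apply (H : 𝓢((Fin l → ℝ) × T, G)) (z v : (Fin l → ℝ) × T) :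
    dint H z v = fderiv ℝ H z (0, v.2) + Complex.I • (v.1 ⬝ᵥ z.1) • H z := by
  rw [← dualDot_apply]; rfl

lemma hasFDerivAt_pint (H : 𝓢((Fin l → ℝ) × T, G)) (z : (Fin l → ℝ) × T) :
    HasFDerivAt (pint H) (pint (dint H) z) z := by
  obtain ⟨p, -, hp⟩ :=
    slice_bound (l := l) (T := T) (G := ((Fin l → ℝ) × T) →L[ℝ] G) 0
  refine hasFDerivAt_integral_of_dominated_of_fderiv_le (s := Set.univ) (𝕜 := ℝ)
    (μ := (volume : Measure (Fin l → ℝ))) (x₀ := z) (F := fun z ξ => chr z.1 ξ • H (ξ, z.2))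
    (F' := fun z ξ => chr z.1 ξ • dint H (ξ, z.2)) (bound := fun ξ => p (dint H) * (1 + ‖ξ‖) ^
      (-((volume : Measure (Fin l → ℝ)).integrablePower : ℝ)))
    Filter.univ_mem ?_ (slice_integrable H z.1 z.2)
    (slice_integrable (dint H) z.1 z.2).aestronglyMeasurable ?_
    ((Measure.integrable_pow_neg_integrablePower volume).const_mul _) ?_
  · exact Filter.Eventually.of_forall fun z => (slice_integrable H z.1 z.2).aestronglyMeasurable
  · filter_upwards with ξ z _
    simpa [norm_smul, norm_chr] using hp (dint H) ξ z.2
  · filter_upwards with ξ z _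
    have h1 : HasFDerivAt (fun z : (Fin l → ℝ) × T => chr z.1 ξ) _ z :=
      ((hasFDerivAt_chr ξ z.1).comp z hasFDerivAt_fst).congr_of_eventuallyEq
        (Filter.Eventually.of_forall fun z => chr_comm _ _)
    have h2 : HasFDerivAt (fun z : (Fin l → ℝ) × T => H (ξ, z.2)) _ z :=
      (H.differentiableAt.hasFDerivAt (x := (ξ, z.2))).comp z
        ((hasFDerivAt_const ξ z).prodMk hasFDerivAt_snd)
    refine (h1.smul h2).congr_fderiv ?_
    refine ContinuousLinearMap.ext fun v => ?_
    have e1 : (∑ x, ξ x * v.1 x) = v.1 ⬝ᵥ ξ := by simp [dotProduct, mul_comm]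
    have e2 : ((v.1 ⬝ᵥ ξ : ℝ) : ℂ) • H (ξ, z.2) = (v.1 ⬝ᵥ ξ) • H (ξ, z.2) :=
      algebraMap_smul ℂ (v.1 ⬝ᵥ ξ) (H (ξ, z.2))
    simp only [smul_apply, add_apply, ContinuousLinearMap.smulRight_apply, dint_apply,
      ContinuousLinearMap.comp_apply, ContinuousLinearMap.prod_apply, smul_add,
      sum_apply, ContinuousLinearMap.proj_apply, smul_eq_mul,
      ContinuousLinearMap.coe_fst', ContinuousLinearMap.coe_snd', zero_apply,
      Complex.ofRealCLM_apply, e1, chr_comm ξ]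
    rw [mul_smul, mul_smul, e2]

lemma pint_contDiff (n : ℕ) : ∀ {G : Type} [NormedAddCommGroup G] [NormedSpace ℝ G]
    [NormedSpace ℂ G] [SMulCommClass ℝ ℂ G] [IsScalarTower ℝ ℂ G]
    (H : 𝓢((Fin l → ℝ) × T, G)), ContDiff ℝ n (pint H) := by
  induction n with
  | zero =>
    intro G _ _ _ _ _ H
    exact contDiff_zero.2 (continuous_iff_continuousAt.2 fun z => (hasFDerivAt_pint H z).continuousAt)
  | succ n ih =>
    intro G _ _ _ _ _ H
    have h : fderiv ℝ (pint H) = pint (dint H) := funext fun z => (hasFDerivAt_pint H z).fderiv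
    push_cast
    refine contDiff_succ_iff_fderiv.2 ⟨fun z => (hasFDerivAt_pint H z).differentiableAt, by simp, ?_⟩
    rw [h]; exact ih _

lemma pint_schwartz (k n : ℕ) : ∀ {G : Type} [NormedAddCommGroup G] [NormedSpace ℝ G]
    [NormedSpace ℂ G] [SMulCommClass ℝ ℂ G] [IsScalarTower ℝ ℂ G],
    ∃ p : Seminorm ℝ 𝓢((Fin l → ℝ) × T, G),
    Continuous p ∧ ∀ (H : 𝓢((Fin l → ℝ) × T, G)) (z : (Fin l → ℝ) × T),
      ‖z‖ ^ k * ‖iteratedFDeriv ℝ n (pint H) z‖ ≤ p H := by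
  induction n with
  | zero =>
    intro G _ _ _ _ _
    simpa using pint_decay (l := l) (T := T) (G := G) k
  | succ n ih =>
    intro G _ _ _ _ _
    obtain ⟨p, hpc, hp⟩ := ih (G := ((Fin l → ℝ) × T) →L[ℝ] G)
    refine ⟨p.comp (dint : _ →L[ℝ] _).toLinearMap, hpc.comp dint.continuous, fun H z => ?_⟩
    have h : fderiv ℝ (pint H) = pint (dint H) := funext fun z => (hasFDerivAt_pint H z).fderiv
    rw [← norm_iteratedFDeriv_fderiv, h]
    exact hp _ _

lemma pint_add (H K : 𝓢((Fin l → ℝ) × T, G)) (z) : pint (H + K) z = pint H z + pint K z := by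
  simp only [pint, add_apply, smul_add]
  exact integral_add (slice_integrable H _ _) (slice_integrable K _ _)

/-- The partial Fourier transform `ψ ↦ ∫ ψ(ξ, t) e^{i⟨s, ξ⟩} dξ` on the Schwartz space. -/
def partialFourier : 𝓢((Fin l → ℝ) × T, ℂ) →L[ℂ] 𝓢((Fin l → ℝ) × T, ℂ) :=
  let L : 𝓢((Fin l → ℝ) × T, ℂ) →L[ℝ] 𝓢((Fin l → ℝ) × T, ℂ) :=
    SchwartzMap.mkCLM (fun H => pint H) pint_add
      (fun c H z => by
        simp only [pint, smul_apply, RingHom.id_apply]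
        rw [← integral_smul]; simp only [smul_comm c])
      (fun H => contDiff_infty.2 fun n => pint_contDiff n H)
      (fun n => by
        obtain ⟨p, hpc, hp⟩ := pint_schwartz (l := l) (T := T) n.1 n.2 (G := ℂ)
        obtain ⟨s, C, -, hC⟩ := Seminorm.bound_of_continuous (schwartz_withSeminorms ℝ _ _) p hpc
        exact ⟨s, C, C.2, fun f x => (hp f x).trans (hC f)⟩)
  { toFun := L
    map_add' := L.map_add
    map_smul' := fun c H => by
      ext z
      change pint (c • H) z = c • pint H z
      simp only [pint, smul_apply]
      rw [← integral_smul]; simp only [smul_comm c]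
    cont := L.continuous }

lemma partialFourier_apply (ψ : 𝓢((Fin l → ℝ) × T, ℂ)) (s : Fin l → ℝ) (t : T) :
    partialFourier ψ (s, t) = ∫ ξ : Fin l → ℝ, chr s ξ * ψ (ξ, t) := rfl

end PartialFourier

section Transpose

variable {k l : ℕ} {E F : Type} [NormedAddCommGroup E] [NormedSpace ℝ E]
  [NormedAddCommGroup F] [NormedSpace ℝ F]

/-- Integration over the first variable, `H ↦ ∫ H(ξ, ·) dξ`, on the Schwartz space. -/
def integrateOut : 𝓢((Fin l → ℝ) × F, ℂ) →L[ℂ] 𝓢(F, ℂ) :=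
  (SchwartzMap.compCLM ℂ (g := ContinuousLinearMap.inr ℝ (Fin l → ℝ) F)
    (ContinuousLinearMap.hasTemperateGrowth _)
    ⟨1, 1, fun x => by simp [Prod.norm_def]⟩).comp partialFourier

lemma integrateOut_apply (H : 𝓢((Fin l → ℝ) × F, ℂ)) (z : F) :
    integrateOut H z = ∫ ξ : Fin l → ℝ, H (ξ, z) := by
  change ∫ ξ : Fin l → ℝ, chr 0 ξ * H (ξ, z) = _
  simp [chr]

lemma norm_iteratedFDeriv_comp_le_of_norm_le_one {g : E →L[ℝ] F} (hg : ‖g‖ ≤ 1) (ψ : 𝓢(F, ℂ))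
    (n : ℕ) (z : E) : ‖iteratedFDeriv ℝ n (fun z => ψ (g z)) z‖ ≤ ‖iteratedFDeriv ℝ n ψ (g z)‖ := by
  change ‖iteratedFDeriv ℝ n (ψ ∘ g) z‖ ≤ _
  rw [g.iteratedFDeriv_comp_right (ψ.smooth ⊤) z (by exact_mod_cast le_top)]
  refine (ContinuousMultilinearMap.norm_compContinuousLinearMap_le _ _).trans ?_
  refine mul_le_of_le_one_right (norm_nonneg _) (Finset.prod_le_one (fun _ _ => norm_nonneg _)
    fun _ _ => hg)

/-- The tensor product `ψ ↦ ((p, q) ↦ f(p) ψ(q))` with a fixed Schwartz function. -/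
def tensor (f : 𝓢(E, ℂ)) : 𝓢(F, ℂ) →L[ℂ] 𝓢(E × F, ℂ) :=
  SchwartzMap.mkCLM (fun ψ z => f z.1 * ψ z.2) (fun ψ χ z => by simp [mul_add])
    (fun c ψ z => by simp [mul_left_comm])
    (fun ψ => ((f.smooth ⊤).comp contDiff_fst).mul ((ψ.smooth ⊤).comp contDiff_snd))
    (by
      rintro ⟨m, n⟩
      set Cf : ℝ := 2 ^ m * (Finset.Iic (m, n)).sup (schwartzSeminormFamily ℂ E ℂ) f
      have hCf : 0 ≤ Cf := by positivity
      refine ⟨Finset.Iic (m, n), ∑ i ∈ Finset.range (n + 1), (n.choose i : ℝ) * Cf * 2 ^ m,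
        by positivity, fun ψ z => ?_⟩
      set P := (Finset.Iic (m, n)).sup (schwartzSeminormFamily ℂ F ℂ) ψ
      have h := norm_iteratedFDeriv_mul_le (𝕜 := ℝ) (N := ∞) (f := fun z : E × F => f z.1)
        (g := fun z : E × F => ψ z.2)
        ((f.smooth ⊤).comp contDiff_fst) ((ψ.smooth ⊤).comp contDiff_snd) z (n := n)
        (by exact_mod_cast le_top)
      have hz : ‖z‖ ^ m ≤ (1 + ‖z.1‖) ^ m * (1 + ‖z.2‖) ^ m := by
        rw [← mul_pow]
        refine pow_le_pow_left₀ (norm_nonneg _) ?_ m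
        have := norm_nonneg z.1
        have := norm_nonneg z.2
        rw [Prod.norm_def]
        refine max_le ?_ ?_ <;> nlinarith [mul_nonneg (norm_nonneg z.1) (norm_nonneg z.2)]
      refine (mul_le_mul_of_nonneg_left h (by positivity)).trans ?_
      rw [Finset.mul_sum, Finset.sum_mul]
      refine Finset.sum_le_sum fun i hi => ?_
      have hi' : i ≤ n := Nat.lt_succ_iff.1 (Finset.mem_range.1 hi)
      have h1 := norm_iteratedFDeriv_comp_le_of_norm_le_one
        (ContinuousLinearMap.norm_fst_le ℝ E F) f i z
      have h2 := norm_iteratedFDeriv_comp_le_of_norm_le_one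
        (ContinuousLinearMap.norm_snd_le ℝ E F) ψ (n - i) z
      have h3 := SchwartzMap.one_add_le_sup_seminorm_apply (𝕜 := ℂ) (m := (m, n)) (k := m)
        (n := i) le_rfl hi' f z.1
      have h4 := SchwartzMap.one_add_le_sup_seminorm_apply (𝕜 := ℂ) (m := (m, n)) (k := m)
        (n := n - i) le_rfl (Nat.sub_le n i) ψ z.2
      calc ‖z‖ ^ m * ((n.choose i : ℝ) * ‖iteratedFDeriv ℝ i (fun z : E × F => f z.1) z‖ *
            ‖iteratedFDeriv ℝ (n - i) (fun z : E × F => ψ z.2) z‖)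
          ≤ ((1 + ‖z.1‖) ^ m * (1 + ‖z.2‖) ^ m) * ((n.choose i : ℝ) *
            ‖iteratedFDeriv ℝ i f z.1‖ * ‖iteratedFDeriv ℝ (n - i) ψ z.2‖) := by
            gcongr
            · exact h1
            · exact h2
        _ = (n.choose i : ℝ) * ((1 + ‖z.1‖) ^ m * ‖iteratedFDeriv ℝ i f z.1‖) *
            ((1 + ‖z.2‖) ^ m * ‖iteratedFDeriv ℝ (n - i) ψ z.2‖) := by ring
        _ ≤ (n.choose i : ℝ) * Cf * (2 ^ m * P) := by
            refine mul_le_mul (mul_le_mul_of_nonneg_left h3 (by positivity)) h4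
              (by positivity) (by positivity)
        _ = _ := by ring)

/-- The value `u(t)` of a matrix of polynomials. -/
def matAt (u : Matrix (Fin l) (Fin k) (MvPolynomial (Fin k) ℝ)) (t : Fin k → ℝ) :
    Matrix (Fin l) (Fin k) ℝ := u.map (MvPolynomial.eval t)

lemma hasTemperateGrowth_eval (p : MvPolynomial (Fin k) ℝ) :
    (fun t : Fin k → ℝ => MvPolynomial.eval t p).HasTemperateGrowth := by
  induction p using MvPolynomial.induction_on with
  | C c => simp
  | add p q hp hq =>
    simp only [map_add]
    exact hp.add hq
  | mul_X p i hp =>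
    simp only [map_mul, MvPolynomial.eval_X]
    exact hp.mul (ContinuousLinearMap.proj (R := ℝ) (φ := fun _ : Fin k => ℝ)
      i).hasTemperateGrowth

lemma hasTemperateGrowth_matAt_mulVec (u : Matrix (Fin l) (Fin k) (MvPolynomial (Fin k) ℝ)) :
    (fun z : (Fin k → ℝ) × (Fin k → ℝ) => matAt u z.2 *ᵥ z.1).HasTemperateGrowth := by
  have h : (fun z : (Fin k → ℝ) × (Fin k → ℝ) => ∑ i : Fin l, ∑ j : Fin k,
      (MvPolynomial.eval z.2 (u i j) * z.1 j) • (Pi.single i 1 : Fin l → ℝ)).HasTemperateGrowth := by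
    refine Function.HasTemperateGrowth.sum fun i _ => Function.HasTemperateGrowth.sum fun j _ => ?_
    refine Function.HasTemperateGrowth.smul (Function.HasTemperateGrowth.mul
      ((hasTemperateGrowth_eval (u i j)).comp
        (ContinuousLinearMap.snd ℝ (Fin k → ℝ) (Fin k → ℝ)).hasTemperateGrowth)
      ((ContinuousLinearMap.proj (R := ℝ) (φ := fun _ : Fin k => ℝ) j).comp
        (ContinuousLinearMap.fst ℝ (Fin k → ℝ) (Fin k → ℝ))).hasTemperateGrowth) (.const _)
  convert h using 2 with z
  ext i
  simp [matAt, Matrix.mulVec, dotProduct, Finset.sum_apply, Pi.single_apply]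

lemma hasTemperateGrowth_prodMk {D : Type} [NormedAddCommGroup D] [NormedSpace ℝ D]
    {g : D → E} {h : D → F} (hg : g.HasTemperateGrowth) (hh : h.HasTemperateGrowth) :
    (fun z => (g z, h z)).HasTemperateGrowth := by
  have := ((ContinuousLinearMap.inl ℝ E F).hasTemperateGrowth.comp hg).add
    ((ContinuousLinearMap.inr ℝ E F).hasTemperateGrowth.comp hh)
  convert this using 2 with z
  simp

/-- The map `(x, y, s, t) ↦ ((x, y), (y - u(t)x - s, t))`. -/
def shear (u : Matrix (Fin l) (Fin k) (MvPolynomial (Fin k) ℝ))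
    (z : (Fin k → ℝ) × ((Fin l → ℝ) × ((Fin l → ℝ) × (Fin k → ℝ)))) :
    ((Fin k → ℝ) × (Fin l → ℝ)) × ((Fin l → ℝ) × (Fin k → ℝ)) :=
  ((z.1, z.2.1), (z.2.1 - matAt u z.2.2.2 *ᵥ z.1 - z.2.2.1, z.2.2.2))

lemma hasTemperateGrowth_shear (u : Matrix (Fin l) (Fin k) (MvPolynomial (Fin k) ℝ)) :
    (shear u).HasTemperateGrowth := by
  have h1 := (ContinuousLinearMap.fst ℝ (Fin k → ℝ)
    ((Fin l → ℝ) × ((Fin l → ℝ) × (Fin k → ℝ)))).hasTemperateGrowth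
  have h2' := (ContinuousLinearMap.snd ℝ (Fin k → ℝ)
    ((Fin l → ℝ) × ((Fin l → ℝ) × (Fin k → ℝ)))).hasTemperateGrowth
  have h2 := (ContinuousLinearMap.fst ℝ _ _).hasTemperateGrowth.comp h2'
  have h3' := (ContinuousLinearMap.snd ℝ _ _).hasTemperateGrowth.comp h2'
  have h3 := (ContinuousLinearMap.fst ℝ _ _).hasTemperateGrowth.comp h3'
  have h4 := (ContinuousLinearMap.snd ℝ _ _).hasTemperateGrowth.comp h3'
  exact hasTemperateGrowth_prodMk (hasTemperateGrowth_prodMk h1 h2) (hasTemperateGrowth_prodMk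
    ((h2.sub ((hasTemperateGrowth_matAt_mulVec u).comp (hasTemperateGrowth_prodMk h1 h4))).sub h3)
    h4)

lemma shear_growth (u : Matrix (Fin l) (Fin k) (MvPolynomial (Fin k) ℝ)) :
    ∃ (m : ℕ) (C : ℝ), ∀ z, ‖z‖ ≤ C * (1 + ‖shear u z‖) ^ m := by
  obtain ⟨m, C, hC⟩ := (hasTemperateGrowth_matAt_mulVec u).2 0
  have hC0 : 0 ≤ C := by
    have := (norm_nonneg _).trans (hC 0)
    simpa using this
  refine ⟨m + 1, C + 2, ?_⟩
  rintro ⟨x, y, s, t⟩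
  set g := ‖shear u (x, y, s, t)‖ with hg
  have hg0 : 0 ≤ g := norm_nonneg _
  have hx : ‖x‖ ≤ g := (norm_fst_le (x, y)).trans (norm_fst_le (shear u (x, y, s, t)))
  have hy : ‖y‖ ≤ g := (norm_snd_le (x, y)).trans (norm_fst_le (shear u (x, y, s, t)))
  have hs' : ‖y - matAt u t *ᵥ x - s‖ ≤ g :=
    (norm_fst_le (y - matAt u t *ᵥ x - s, t)).trans (norm_snd_le (shear u (x, y, s, t)))
  have ht : ‖t‖ ≤ g :=
    (norm_snd_le (y - matAt u t *ᵥ x - s, t)).trans (norm_snd_le (shear u (x, y, s, t)))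
  have hu : ‖matAt u t *ᵥ x‖ ≤ C * (1 + g) ^ m := by
    have := hC (x, t)
    rw [norm_iteratedFDeriv_zero] at this
    refine this.trans ?_
    have : ‖(x, t)‖ ≤ g := by rw [Prod.norm_def]; exact max_le hx ht
    gcongr
  have hs : ‖s‖ ≤ 2 * g + C * (1 + g) ^ m := by
    have e : s = y - matAt u t *ᵥ x - (y - matAt u t *ᵥ x - s) := by abel
    calc ‖s‖ = ‖y - matAt u t *ᵥ x - (y - matAt u t *ᵥ x - s)‖ := by rw [← e]
      _ ≤ ‖y‖ + ‖matAt u t *ᵥ x‖ + ‖y - matAt u t *ᵥ x - s‖ :=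
        (norm_sub_le _ _).trans (add_le_add_left (norm_sub_le _ _) _)
      _ ≤ _ := by linarith
  have hp : 1 ≤ (1 + g) ^ m := one_le_pow₀ (by linarith)
  have hb : 2 * g + C * (1 + g) ^ m ≤ (C + 2) * (1 + g) ^ (m + 1) := by
    rw [pow_succ]
    have h1 : g ≤ (1 + g) ^ m * (1 + g) := by nlinarith
    have h2 : (1 + g) ^ m ≤ (1 + g) ^ m * (1 + g) := by nlinarith
    nlinarith
  have hb' : g ≤ (C + 2) * (1 + g) ^ (m + 1) := by
    have : 0 ≤ C * (1 + g) ^ m := by positivity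
    linarith
  simp only [Prod.norm_def]
  exact max_le (hx.trans hb') (max_le (hy.trans hb') (max_le (hs.trans hb) (ht.trans hb')))

/-- The operator `ψ(α, t) ↦ ∫∫ f(x, y) ψ(y - u(t)x - s, t) dx dy` (a function of `(s, t)`). -/
def transpose (u : Matrix (Fin l) (Fin k) (MvPolynomial (Fin k) ℝ))
    (f : 𝓢((Fin k → ℝ) × (Fin l → ℝ), ℂ)) :
    𝓢((Fin l → ℝ) × (Fin k → ℝ), ℂ) →L[ℂ] 𝓢((Fin l → ℝ) × (Fin k → ℝ), ℂ) :=
  integrateOut.comp (integrateOut.comp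
    ((SchwartzMap.compCLM ℂ (hasTemperateGrowth_shear u) (shear_growth u)).comp (tensor f)))

lemma transpose_apply (u : Matrix (Fin l) (Fin k) (MvPolynomial (Fin k) ℝ))
    (f : 𝓢((Fin k → ℝ) × (Fin l → ℝ), ℂ)) (ψ : 𝓢((Fin l → ℝ) × (Fin k → ℝ), ℂ))
    (s : Fin l → ℝ) (t : Fin k → ℝ) :
    transpose u f ψ (s, t) =
      ∫ y : Fin l → ℝ, ∫ x : Fin k → ℝ, f (x, y) * ψ (y - matAt u t *ᵥ x - s, t) := by
  simp only [transpose, ContinuousLinearMap.comp_apply, integrateOut_apply]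
  rfl

end Transpose

section Transform

variable {k l : ℕ}

/-- The transform `J_a f` of `f`, for a generalized function `a(s, t)`: the generalized function
`φ(α, t) = ∫∫ f(x, y) a(y - u(t)x - α, t) dx dy`. Tested against `ψ(α, t)`, after the
substitution `s = y - u(t)x - α`, it is `a` applied to
`(s, t) ↦ ∫∫ f(x, y) ψ(y - u(t)x - s, t) dx dy`. -/
def transform (u : Matrix (Fin l) (Fin k) (MvPolynomial (Fin k) ℝ))
    (a : 𝓢'((Fin l → ℝ) × (Fin k → ℝ), ℂ)) (f : 𝓢((Fin k → ℝ) × (Fin l → ℝ), ℂ)) :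
    𝓢'((Fin l → ℝ) × (Fin k → ℝ), ℂ) :=
  PointwiseConvergenceCLM.precomp ℂ (transpose u f) a

lemma transform_apply (u : Matrix (Fin l) (Fin k) (MvPolynomial (Fin k) ℝ))
    (a : 𝓢'((Fin l → ℝ) × (Fin k → ℝ), ℂ)) (f : 𝓢((Fin k → ℝ) × (Fin l → ℝ), ℂ))
    (ψ : 𝓢((Fin l → ℝ) × (Fin k → ℝ), ℂ)) :
    transform u a f ψ = a (transpose u f ψ) := rfl

/-- The Fourier transform of the tempered generalized function `a(s, t)` with respect to `s`,
`∫ a(s, t) e^{i⟨s, ξ⟩} ds`, is the ordinary (locally integrable) function `g(ξ, t)`. -/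
def HasPartialFourier (a : 𝓢'((Fin l → ℝ) × (Fin k → ℝ), ℂ))
    (g : (Fin l → ℝ) × (Fin k → ℝ) → ℂ) : Prop :=
  LocallyIntegrable g ∧ ∀ ψ : 𝓢((Fin l → ℝ) × (Fin k → ℝ), ℂ), HasCompactSupport ψ →
    a (partialFourier ψ) = ∫ q, g q * ψ q

/-- The number of solutions `t` of `η = -ξ u(t)`. -/
def crofton (u : Matrix (Fin l) (Fin k) (MvPolynomial (Fin k) ℝ)) (η : Fin k → ℝ)
    (ξ : Fin l → ℝ) : ℕ∞ :=
  {t : Fin k → ℝ | η = -(ξ ᵥ* matAt u t)}.encard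

/-- The Jacobian determinant `ω(ξ, t) = ∂(ξ u(t)) / ∂t`. -/
def jacobian (u : Matrix (Fin l) (Fin k) (MvPolynomial (Fin k) ℝ)) (ξ : Fin l → ℝ)
    (t : Fin k → ℝ) : ℝ :=
  (fderiv ℝ (fun τ : Fin k → ℝ => ξ ᵥ* matAt u τ) t).det

/-- The density `(2π)^{-(k+l)} |ω(ξ, t)| / (Cr(-ξ u(t), ξ) ã(ξ, t))` in the Fourier integral
of the inverse kernel `A(s, t)`. -/
def inverseDensity (u : Matrix (Fin l) (Fin k) (MvPolynomial (Fin k) ℝ))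
    (aHat : (Fin l → ℝ) × (Fin k → ℝ) → ℂ) (q : (Fin l → ℝ) × (Fin k → ℝ)) : ℂ :=
  ((2 * Real.pi : ℝ) ^ (k + l) : ℂ)⁻¹ * (|jacobian u q.1 q.2| : ℝ) /
    ((crofton u (-(q.1 ᵥ* matAt u q.2)) q.1).toNat * aHat q)

/-- The inverse kernel `A(s, t) = ∫ b(ξ, t) e^{i⟨s, ξ⟩} dξ`, with `b` the density
`inverseDensity`, where this integral converges absolutely. -/
def inverseKernel (u : Matrix (Fin l) (Fin k) (MvPolynomial (Fin k) ℝ))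
    (aHat : (Fin l → ℝ) × (Fin k → ℝ) → ℂ) (s : Fin l → ℝ) (t : Fin k → ℝ) : ℂ :=
  ∫ ξ : Fin l → ℝ, inverseDensity u aHat (ξ, t) * chr s ξ

/-- `∫∫ φ(α, t) A(β(t) - α, t) dα dt = v`, where `φ` is a generalized function and `A` is the
generalized function given by the (possibly divergent) Fourier integral
`A(s, t) = ∫ b(ξ, t) e^{i⟨s, ξ⟩} dξ`. As usual, the integral of `A` against `φ` is obtained by
integrating first in `α`: writing `Φ(ξ, t) = ∫ φ(α, t) e^{i⟨α, ξ⟩} dα`, one has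
`∫ φ(α, t) e^{i⟨β(t) - α, ξ⟩} dα = Φ(-ξ, t) e^{i⟨β(t), ξ⟩}`. It is required that `Φ` be an
ordinary function and that the resulting integral over `(ξ, t)` converge absolutely. -/
def HasKernelIntegral (φ : 𝓢'((Fin l → ℝ) × (Fin k → ℝ), ℂ))
    (b : (Fin l → ℝ) × (Fin k → ℝ) → ℂ) (β : (Fin k → ℝ) → (Fin l → ℝ)) (v : ℂ) : Prop :=
  ∃ Φ : (Fin l → ℝ) × (Fin k → ℝ) → ℂ, HasPartialFourier φ Φ ∧
    Integrable (fun q : (Fin l → ℝ) × (Fin k → ℝ) => b q * Φ (-q.1, q.2) * chr (β q.2) q.1) ∧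
    ∫ q : (Fin l → ℝ) × (Fin k → ℝ), b q * Φ (-q.1, q.2) * chr (β q.2) q.1 = v

/-- The partial Fourier transform is unique up to null sets, so that the value in
`HasKernelIntegral` is well defined. -/
lemma HasPartialFourier.ae_eq {φ : 𝓢'((Fin l → ℝ) × (Fin k → ℝ), ℂ)}
    {g h : (Fin l → ℝ) × (Fin k → ℝ) → ℂ} (hg : HasPartialFourier φ g)
    (hh : HasPartialFourier φ h) : g =ᵐ[volume] h := by
  refine ae_eq_of_integral_contDiff_smul_eq hg.1 hh.1 fun ρ hρ hc => ?_
  have hc' : HasCompactSupport (fun q => (ρ q : ℂ)) :=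
    hc.comp_left (g := fun r : ℝ => (r : ℂ)) Complex.ofReal_zero
  have hs : ContDiff ℝ ∞ (fun q => (ρ q : ℂ)) := Complex.ofRealCLM.contDiff.comp hρ
  have := (hg.2 (hc'.toSchwartzMap hs) hc').symm.trans (hh.2 (hc'.toSchwartzMap hs) hc')
  have e : ∀ q, hc'.toSchwartzMap hs q = (ρ q : ℂ) := fun _ => rfl
  simp only [e] at this
  simpa [mul_comm] using this

end Transform

section Adequacy

variable {k l : ℕ}

lemma integrable_triple {g : (Fin l → ℝ) × (Fin k → ℝ) → ℂ}
    (hg : ∀ C : Set (Fin k → ℝ), IsCompact C → IntegrableOn g (Set.univ ×ˢ C))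
    {B : Set (Fin l → ℝ)} {C : Set (Fin k → ℝ)} (hB : IsCompact B) (hC : IsCompact C) :
    Integrable (fun p : (Fin l → ℝ) × ((Fin l → ℝ) × (Fin k → ℝ)) =>
      B.indicator (fun _ => (1 : ℂ)) p.1 *
        (Set.univ ×ˢ C : Set ((Fin l → ℝ) × (Fin k → ℝ))).indicator g p.2) := by
  refine Integrable.mul_prod (μ := volume) (ν := volume) ?_ ?_
  · exact (integrable_indicator_iff hB.measurableSet).2
      (integrableOn_const hB.measure_lt_top.ne)
  · exact (integrable_indicator_iff (MeasurableSet.univ.prod hC.measurableSet)).2 (hg C hC)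

/-- The map `((ξ, t), α) ↦ (ξ, (α, t))` preserves Lebesgue measure. -/
lemma measurePreserving_rearrange :
    MeasurePreserving (fun p : ((Fin l → ℝ) × (Fin k → ℝ)) × (Fin l → ℝ) =>
      (p.1.1, (p.2, p.1.2))) := by
  have h1 := MeasureTheory.measurePreserving_prodAssoc (volume : Measure (Fin l → ℝ))
    (volume : Measure (Fin k → ℝ)) (volume : Measure (Fin l → ℝ))
  have h2 := (MeasurePreserving.id (volume : Measure (Fin l → ℝ))).prod
    (Measure.measurePreserving_swap (μ := (volume : Measure (Fin k → ℝ)))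
      (ν := (volume : Measure (Fin l → ℝ))))
  exact h2.comp h1

/-- The classical partial Fourier transform. -/
def classicalFourier (g : (Fin l → ℝ) × (Fin k → ℝ) → ℂ) (q : (Fin l → ℝ) × (Fin k → ℝ)) : ℂ :=
  ∫ α : Fin l → ℝ, chr α q.1 * g (α, q.2)

lemma locallyIntegrable_classicalFourier {g : (Fin l → ℝ) × (Fin k → ℝ) → ℂ}
    (hg : ∀ C : Set (Fin k → ℝ), IsCompact C → IntegrableOn g (Set.univ ×ˢ C)) :
    LocallyIntegrable (classicalFourier g) := by
  rw [locallyIntegrable_iff]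
  intro K hK
  have hB : IsCompact (Prod.fst '' K) := hK.image continuous_fst
  have hC : IsCompact (Prod.snd '' K) := hK.image continuous_snd
  have h := (measurePreserving_rearrange.integrable_comp_of_integrable
    (integrable_triple hg hB hC))
  have h2 := h.bdd_mul (c := 1) (f := fun p => chr p.2 p.1.1)
    (by exact (continuous_chr.comp (by fun_prop :
      Continuous fun p : ((Fin l → ℝ) × (Fin k → ℝ)) × (Fin l → ℝ) => (p.2, p.1.1))
      ).aestronglyMeasurable) (Filter.Eventually.of_forall fun p => (norm_chr _ _).le)
  have h3 := h2.integral_prod_left.integrableOn (s := K)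
  refine h3.congr_fun (fun q hq => ?_) hK.measurableSet
  have e1 : q.1 ∈ Prod.fst '' K := ⟨q, hq, rfl⟩
  have e2 : q.2 ∈ Prod.snd '' K := ⟨q, hq, rfl⟩
  refine integral_congr_ae (Filter.Eventually.of_forall fun α => ?_)
  simp only [Function.comp, Set.indicator_of_mem e1, one_mul]
  rw [Set.indicator_of_mem (show (α, q.2) ∈ Set.univ ×ˢ (Prod.snd '' K) from ⟨trivial, e2⟩)]

lemma integral_classicalFourier_mul {g : (Fin l → ℝ) × (Fin k → ℝ) → ℂ}
    (hg : ∀ C : Set (Fin k → ℝ), IsCompact C → IntegrableOn g (Set.univ ×ˢ C))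
    (ψ : 𝓢((Fin l → ℝ) × (Fin k → ℝ), ℂ)) (hψ : HasCompactSupport ψ) :
    ∫ q, g q * partialFourier ψ q = ∫ q, classicalFourier g q * ψ q := by
  have hB : IsCompact (Prod.fst '' tsupport ψ) := hψ.isCompact.image continuous_fst
  have hC : IsCompact (Prod.snd '' tsupport ψ) := hψ.isCompact.image continuous_snd
  obtain ⟨M, hM⟩ : ∃ M, ∀ q, ‖ψ q‖ ≤ M := ⟨_, ψ.norm_le_seminorm ℝ⟩
  have h2 := (integrable_triple hg hB hC).bdd_mul (c := M)
    (f := fun p => chr p.2.1 p.1 * ψ (p.1, p.2.2))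
    (by
      exact ((continuous_chr.comp (by fun_prop : Continuous
        fun p : (Fin l → ℝ) × ((Fin l → ℝ) × (Fin k → ℝ)) => (p.2.1, p.1))).mul
        (ψ.continuous.comp (by fun_prop))).aestronglyMeasurable)
    (Filter.Eventually.of_forall fun p => by
      rw [norm_mul, norm_chr, one_mul]; exact hM _)
  have h3 : Integrable (fun p : (Fin l → ℝ) × ((Fin l → ℝ) × (Fin k → ℝ)) =>
      chr p.2.1 p.1 * ψ (p.1, p.2.2) * g p.2) := by
    refine h2.congr (Filter.Eventually.of_forall fun p => ?_)
    by_cases hp : (p.1, p.2.2) ∈ tsupport ψ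
    · have e1 : p.1 ∈ Prod.fst '' tsupport ψ := ⟨_, hp, rfl⟩
      have e2 : p.2 ∈ (Set.univ : Set (Fin l → ℝ)) ×ˢ (Prod.snd '' tsupport ψ) :=
        ⟨trivial, ⟨_, hp, rfl⟩⟩
      simp only [Set.indicator_of_mem e1, Set.indicator_of_mem e2, one_mul]
    · simp only [image_eq_zero_of_notMem_tsupport hp, mul_zero, zero_mul]
  have h4 := measurePreserving_rearrange.integrable_comp_of_integrable h3
  calc ∫ q, g q * partialFourier ψ q
      = ∫ q : (Fin l → ℝ) × (Fin k → ℝ), ∫ ξ : Fin l → ℝ,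
          chr q.1 ξ * ψ (ξ, q.2) * g q := by
        refine integral_congr_ae (Filter.Eventually.of_forall fun q => ?_)
        simp only
        rw [show q = (q.1, q.2) from rfl, partialFourier_apply, mul_comm, ← integral_mul_const]
    _ = ∫ p : (Fin l → ℝ) × ((Fin l → ℝ) × (Fin k → ℝ)),
          chr p.2.1 p.1 * ψ (p.1, p.2.2) * g p.2 := (integral_prod_symm _ h3).symm
    _ = ∫ p : ((Fin l → ℝ) × (Fin k → ℝ)) × (Fin l → ℝ),
          chr p.2 p.1.1 * ψ (p.1.1, p.1.2) * g (p.2, p.1.2) := by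
        rw [← measurePreserving_rearrange.map_eq, integral_map
          measurePreserving_rearrange.aemeasurable]
        rw [measurePreserving_rearrange.map_eq]
        exact h3.aestronglyMeasurable
    _ = ∫ q, classicalFourier g q * ψ q := by
        refine (integral_prod _ h4).trans
          (integral_congr_ae (Filter.Eventually.of_forall fun q => ?_))
        simp only [classicalFourier]
        rw [← integral_mul_const]
        refine integral_congr_ae (Filter.Eventually.of_forall fun α => ?_)
        simp only [Function.comp]
        ring

lemma fubini_slice {b g : (Fin l → ℝ) → ℂ} (hb : Integrable b) (hg : Integrable g)
    (β : Fin l → ℝ) :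
    ∫ ξ, b ξ * (∫ α, chr α (-ξ) * g α) * chr β ξ = ∫ α, g α * ∫ ξ, b ξ * chr (β - α) ξ := by
  have hcont : Continuous fun p : (Fin l → ℝ) × (Fin l → ℝ) => chr (β - p.2) p.1 :=
    continuous_chr.comp (by fun_prop : Continuous
      fun p : (Fin l → ℝ) × (Fin l → ℝ) => (β - p.2, p.1))
  have hprod : Integrable (fun p : (Fin l → ℝ) × (Fin l → ℝ) =>
      chr (β - p.2) p.1 * (b p.1 * g p.2)) (volume.prod volume) :=
    (Integrable.mul_prod hb hg).bdd_mul (c := 1) hcont.aestronglyMeasurable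
      (Filter.Eventually.of_forall fun p => (norm_chr _ _).le)
  have hchr : ∀ ξ α : Fin l → ℝ, chr (β - α) ξ = chr α (-ξ) * chr β ξ := fun ξ α => by
    simp only [chr, ← Complex.exp_add, sub_dotProduct, dotProduct_neg]
    push_cast; ring_nf
  calc ∫ ξ, b ξ * (∫ α, chr α (-ξ) * g α) * chr β ξ
      = ∫ ξ, ∫ α, chr (β - α) ξ * (b ξ * g α) := by
        refine integral_congr_ae (Filter.Eventually.of_forall fun ξ => ?_)
        simp only
        rw [← integral_const_mul, ← integral_mul_const]
        refine integral_congr_ae (Filter.Eventually.of_forall fun α => ?_)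
        simp only [hchr]; ring
    _ = ∫ α, ∫ ξ, chr (β - α) ξ * (b ξ * g α) := integral_integral_swap hprod
    _ = _ := by
        refine integral_congr_ae (Filter.Eventually.of_forall fun α => ?_)
        simp only
        rw [← integral_const_mul]
        refine integral_congr_ae (Filter.Eventually.of_forall fun ξ => ?_)
        simp only; ring

/-- If `φ` is an ordinary function that is integrable over `ℝˡ × C` for every compact `C`, and
the Fourier integral of the kernel converges absolutely, then `HasKernelIntegral` is the literal
iterated integral. -/
lemma HasKernelIntegral.eq_integral {φ : 𝓢'((Fin l → ℝ) × (Fin k → ℝ), ℂ)}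
    {b : (Fin l → ℝ) × (Fin k → ℝ) → ℂ} {β : (Fin k → ℝ) → (Fin l → ℝ)} {v : ℂ}
    (h : HasKernelIntegral φ b β v) {g : (Fin l → ℝ) × (Fin k → ℝ) → ℂ}
    (hg : ∀ C : Set (Fin k → ℝ), IsCompact C → IntegrableOn g (Set.univ ×ˢ C))
    (hφ : ∀ ψ, φ ψ = ∫ q, g q * ψ q) (hb : ∀ᵐ t : Fin k → ℝ, Integrable fun ξ => b (ξ, t)) :
    v = ∫ t : Fin k → ℝ, ∫ α : Fin l → ℝ,
      g (α, t) * ∫ ξ : Fin l → ℝ, b (ξ, t) * chr (β t - α) ξ := by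
  obtain ⟨Φ, hΦ, hint, rfl⟩ := h
  have hΦ' : HasPartialFourier φ (classicalFourier g) :=
    ⟨locallyIntegrable_classicalFourier hg, fun ψ hψ => by
      rw [hφ, integral_classicalFourier_mul hg ψ hψ]⟩
  have hae : ∀ᵐ q : (Fin l → ℝ) × (Fin k → ℝ), Φ (-q.1, q.2) = classicalFourier g (-q.1, q.2) := by
    have hm : MeasurePreserving (fun q : (Fin l → ℝ) × (Fin k → ℝ) => (-q.1, q.2)) :=
      (Measure.measurePreserving_neg (volume : Measure (Fin l → ℝ))).prod
        (MeasurePreserving.id (volume : Measure (Fin k → ℝ)))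
    exact hm.quasiMeasurePreserving.ae (hΦ.ae_eq hΦ')
  have hgt : ∀ᵐ t : Fin k → ℝ, Integrable fun α => g (α, t) := by
    have : ∀ n : ℕ, ∀ᵐ t : Fin k → ℝ, t ∈ Metric.closedBall (0 : Fin k → ℝ) n →
        Integrable fun α => g (α, t) := fun n => by
      have h1 := hg _ (isCompact_closedBall (0 : Fin k → ℝ) n)
      rw [IntegrableOn, Measure.volume_eq_prod, ← Measure.prod_restrict,
        Measure.restrict_univ] at h1
      exact (ae_restrict_iff' Metric.isClosed_closedBall.measurableSet).1 h1.prod_left_ae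
    filter_upwards [ae_all_iff.2 this] with t ht
    obtain ⟨n, hn⟩ := exists_nat_ge ‖t‖
    exact ht n (by simpa using hn)
  have hae' : ∀ᵐ t : Fin k → ℝ, ∀ᵐ ξ : Fin l → ℝ,
      Φ (-ξ, t) = classicalFourier g (-ξ, t) :=
    Measure.ae_ae_of_ae_prod ((Measure.measurePreserving_swap
      (μ := (volume : Measure (Fin k → ℝ))) (ν := (volume : Measure (Fin l → ℝ)))
      ).quasiMeasurePreserving.ae hae)
  refine (integral_prod_symm _ hint).trans (integral_congr_ae ?_)
  filter_upwards [hb, hgt, hae'] with t hbt hgt hΦt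
  refine Eq.trans (integral_congr_ae ?_) (fubini_slice hbt hgt (β t))
  filter_upwards [hΦt] with ξ hξ
  rw [hξ, classicalFourier]

end Adequacy

end PlaneComplex

end

noncomputable section

/-! The formula is Fourier inversion on `ℝⁿ` written in the coordinates `(ξ, t)`.

Slice theorem: since `⟨y - u(t)x, ξ⟩ = ⟨x, -ξu(t)⟩ + ⟨y, ξ⟩`, the partial Fourier transform of `J_a
f` at `(-ξ, t)` is `ã(ξ, t)` times the Fourier transform of `f` at the conormal `(-ξu(t), ξ)`. For
generalized `a` this is proved on test functions (`transpose_partialFourier_apply`) and then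
dualized (`hasPartialFourier_transform`). Multiplying by `b` cancels `ã`, so the integrand becomes
`(2π)⁻ⁿ |ω| / Cr` times the inversion integrand of `f` at that conormal.

Area formula: `conormalMap`, `(ξ, t) ↦ (ξ, -ξu(t))`, has Jacobian `ω` up to sign and its fibres are
counted by the Crofton function. Hence the measure `|ω| / Cr dξ dt` is carried to Lebesgue measure
as soon as `Cr` is finite and nonzero almost everywhere (`integral_abs_det_smul_comp`), which also
gives absolute integrability. What is left is ordinary Fourier inversion
(`integral_prodFourier_mul`).

The literal version for ordinary `φ` follows by exchanging the `ξ` and `α` integrals for almost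
every fixed `t`. -/

namespace PlaneComplex

/-! ### Area formula with multiplicity for differentiable maps -/

section AreaFormula

open Set Function
open scoped ENNReal NNReal

variable {E : Type*} [NormedAddCommGroup E] [NormedSpace ℝ E] [FiniteDimensional ℝ E]

/-- An invertible linear map has a neighbourhood such that every map approximated by it up to
this precision is injective. -/
lemma exists_injOn_of_approximatesLinearOn (A : E →L[ℝ] E) :
    ∃ r : ℝ≥0, r ≠ 0 ∧ (A.det ≠ 0 → ∀ (G : E → E) (s : Set E),
      ApproximatesLinearOn G A s r → InjOn G s) := by
  by_cases hA : A.det = 0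
  · exact ⟨1, one_ne_zero, fun h => absurd hA h⟩
  set B := A.toContinuousLinearEquivOfDetNeZero hA
  have hB : (B : E →L[ℝ] E) = A := A.coe_toContinuousLinearEquivOfDetNeZero hA
  rcases subsingleton_or_nontrivial E with hE | hE
  · exact ⟨1, one_ne_zero, fun _ G s _ => injOn_of_injective (injective_of_subsingleton G)⟩
  · have hpos : 0 < ‖(B.symm : E →L[ℝ] E)‖₊⁻¹ := inv_pos.2 B.nnnorm_symm_pos
    -- Any `r` below `‖A⁻¹‖⁻¹` works: `A` separates points at rate at least `‖A⁻¹‖⁻¹`, and an error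
    -- of Lipschitz constant `r` cannot undo this. The value `1` in the degenerate cases is
    -- arbitrary; it makes `r` defined for every `A`, as the partition theorem demands.
    obtain ⟨r, hr, hr'⟩ := exists_between hpos
    exact ⟨r, hr.ne', fun _ G s h => ApproximatesLinearOn.injOn (f' := B)
      (by rw [hB]; exact h) (Or.inr hr')⟩

variable [MeasurableSpace E] [BorelSpace E] (μ : Measure E) [μ.IsAddHaarMeasure]

/-- A differentiable map is injective on each of countably many disjoint measurable sets that
cover its regular points. -/
lemma exists_injOn_partition {G : E → E} (hG : Differentiable ℝ G) :
    ∃ t : ℕ → Set E, Pairwise (Disjoint on t) ∧ (∀ n, MeasurableSet (t n)) ∧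
      (∀ n, InjOn G (t n)) ∧ ⋃ n, t n = {x | (fderiv ℝ G x).det ≠ 0} := by
  set s : Set E := {x | (fderiv ℝ G x).det ≠ 0}
  have hs : MeasurableSet s :=
    (ContinuousLinearMap.continuous_det.measurable.comp (measurable_fderiv ℝ G))
      (measurableSet_singleton (0 : ℝ)).compl
  choose r hr hinj using exists_injOn_of_approximatesLinearOn (E := E)
  obtain ⟨t, A, hd, hm, hc, hA, hy⟩ := exists_partition_approximatesLinearOn_of_hasFDerivWithinAt
    G s (fderiv ℝ G) (fun x _ => (hG x).hasFDerivAt.hasFDerivWithinAt) r hr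
  refine ⟨fun n => s ∩ t n, fun m n hmn => (hd hmn).mono inter_subset_right inter_subset_right,
    fun n => hs.inter (hm n), fun n => ?_, ?_⟩
  · rcases s.eq_empty_or_nonempty with h | h
    · simp [h]
    -- The approximating map `A n` is the derivative at some regular point, hence invertible.
    · obtain ⟨y, hys, hyn⟩ := hy h n
      exact hinj (A n) (by rw [hyn]; exact hys) G _ (hA n)
  · rw [← inter_iUnion, inter_eq_left]; exact hc

/-- The area formula: a differentiable map pushes the measure with density `|det G'|` forward to
the measure whose density is the number of preimages. -/
theorem exists_map_withDensity_abs_det {G : E → E} (hG : Differentiable ℝ G) :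
    ∃ N : E → ℝ≥0∞, Measurable N ∧ (∀ᵐ z ∂μ, N z = ((G ⁻¹' {z}).encard : ℝ≥0∞)) ∧
      (μ.withDensity fun x => ENNReal.ofReal |(fderiv ℝ G x).det|).map G = μ.withDensity N := by
  obtain ⟨t, hd, hm, hinj, ht⟩ := exists_injOn_partition hG
  have hGm : Measurable G := hG.continuous.measurable
  have himg : ∀ n, MeasurableSet (G '' t n) := fun n =>
    measurable_image_of_fderivWithin (hm n)
      (fun x _ => (hG x).hasFDerivAt.hasFDerivWithinAt) (hinj n)
  -- `N` counts the pieces whose image contains `z`, that is, the regular preimages of `z`. It is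
  -- measurable because injective differentiable images of measurable sets are, and it can differ
  -- from the full count only at critical values.
  refine ⟨fun z => ∑' n, (G '' t n).indicator 1 z,
    Measurable.tsum fun n => measurable_one.indicator (himg n), ?_, ?_⟩
  -- Sard: critical values are negligible, so almost every fibre lies in the union of the pieces.
  · have h0 : μ (G '' {x | (fderiv ℝ G x).det = 0}) = 0 :=
      addHaar_image_eq_zero_of_det_fderivWithin_eq_zero μ
        (fun x _ => (hG x).hasFDerivAt.hasFDerivWithinAt) fun x hx => hx
    filter_upwards [compl_mem_ae_iff.2 h0] with z hz
    have hzm : MeasurableSet (G ⁻¹' {z}) := hGm (measurableSet_singleton z)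
    have hU : G ⁻¹' {z} = ⋃ n, G ⁻¹' {z} ∩ t n := by
      rw [← inter_iUnion, ht, left_eq_inter]
      exact fun x hx h => hz ⟨x, h, hx⟩
    -- Writing the cardinality as a counting measure makes it countably additive; each piece then
    -- contributes one point or none.
    rw [← Measure.count_apply hzm, hU, measure_iUnion
      (fun m n hmn => (hd hmn).mono inter_subset_right inter_subset_right)
      (fun n => hzm.inter (hm n))]
    refine tsum_congr fun n => ?_
    by_cases h : z ∈ G '' t n
    · obtain ⟨x, hx, rfl⟩ := h
      have : G ⁻¹' {G x} ∩ t n = {x} := by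
        ext w
        exact ⟨fun hw => hinj n hw.2 hx hw.1, fun hw => by rw [hw]; exact ⟨rfl, hx⟩⟩
      rw [this, Measure.count_singleton, indicator_of_mem (mem_image_of_mem G hx)]; rfl
    · have : G ⁻¹' {z} ∩ t n = ∅ := by
        ext w
        exact ⟨fun hw => h ⟨w, hw.2, hw.1⟩, fun hw => hw.elim⟩
      rw [this, measure_empty, indicator_of_notMem h]
  · ext S hS
    have hSm := hGm hS
    have hdet : MeasurableSet {x | (fderiv ℝ G x).det ≠ 0} := by
      rw [← ht]; exact MeasurableSet.iUnion hm
    rw [Measure.map_apply hGm hS, withDensity_apply _ hSm, withDensity_apply _ hS,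
      lintegral_tsum fun n => (measurable_one.indicator (himg n)).aemeasurable]
    -- The density vanishes at critical points, so only the pieces contribute.
    have h1 : ∫⁻ x in G ⁻¹' S, ENNReal.ofReal |(fderiv ℝ G x).det| ∂μ =
        ∫⁻ x in ⋃ n, t n ∩ G ⁻¹' S, ENNReal.ofReal |(fderiv ℝ G x).det| ∂μ := by
      rw [← iUnion_inter, ht, ← setLIntegral_indicator hdet]
      refine lintegral_congr fun x => ?_
      by_cases hx : (fderiv ℝ G x).det = 0
      · rw [indicator_of_notMem (by simpa using hx), hx]; simp
      · rw [indicator_of_mem (by simpa using hx)]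
    rw [h1, lintegral_iUnion (fun n => (hm n).inter hSm)
      (fun m n hmn => (hd hmn).mono inter_subset_left inter_subset_left)]
    refine tsum_congr fun n => ?_
    -- Injective change of variables on one piece: both sides are `μ (G(t n) ∩ S)`.
    rw [lintegral_abs_det_fderiv_eq_addHaar_image μ ((hm n).inter hSm)
      (fun x _ => (hG x).hasFDerivAt.hasFDerivWithinAt) ((hinj n).mono inter_subset_left),
      image_inter_preimage, lintegral_indicator_one (himg n), Measure.restrict_apply (himg n)]

/-- Change of variables along a map whose number of preimages is almost everywhere finite and
nonzero. -/
theorem integral_abs_det_smul_comp {F : Type*} [NormedAddCommGroup F] [NormedSpace ℝ F]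
    {G : E → E} (hG : Differentiable ℝ G)
    (hN : ∀ᵐ z ∂μ, (G ⁻¹' {z}).encard ≠ 0 ∧ (G ⁻¹' {z}).encard ≠ ⊤) {h : E → F}
    (hh : Integrable h μ) :
    Integrable (fun q => |(fderiv ℝ G q).det| •
      ((G ⁻¹' {G q}).encard.toNat : ℝ)⁻¹ • h (G q)) μ ∧
    ∫ q, |(fderiv ℝ G q).det| • ((G ⁻¹' {G q}).encard.toNat : ℝ)⁻¹ • h (G q) ∂μ =
      ∫ z, h z ∂μ := by
  obtain ⟨N, hNm, hNe, hmap⟩ := exists_map_withDensity_abs_det μ hG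
  have hGm : Measurable G := hG.continuous.measurable
  have hDm : Measurable fun x => ENNReal.ofReal |(fderiv ℝ G x).det| :=
    ((ContinuousLinearMap.continuous_det.measurable.comp
      (measurable_fderiv ℝ G)).abs).ennreal_ofReal
  set ν := μ.withDensity fun x => ENNReal.ofReal |(fderiv ℝ G x).det| with hν
  -- Dividing by the multiplicity beforehand gives `N • w = h` almost everywhere, so integrating `w`
  -- against the pushed-forward measure returns `∫ h`.
  set w : E → F := fun z => ((G ⁻¹' {z}).encard.toNat : ℝ)⁻¹ • h z with hw
  have hNr : ∀ᵐ z ∂μ, (N z).toReal = (G ⁻¹' {z}).encard.toNat ∧ (N z).toReal ≠ 0 ∧ N z < ⊤ := by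
    filter_upwards [hNe, hN] with z h1 h2
    obtain ⟨m, hm⟩ := ENat.ne_top_iff_exists.1 h2.2
    have hm0 : m ≠ 0 := fun h => h2.1 (by rw [← hm, h]; rfl)
    rw [h1, ← hm]
    simpa using hm0
  have hfin : ∀ᵐ z ∂μ, N z < ⊤ := hNr.mono fun z hz => hz.2.2
  have hsmul : (fun z => (N z).toReal • w z) =ᵐ[μ] h := by
    filter_upwards [hNr] with z hz
    simp only [hw]
    rw [← hz.1, smul_smul, mul_inv_cancel₀ hz.2.1, one_smul]
  have hwi : Integrable w (μ.withDensity N) :=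
    (integrable_withDensity_iff_integrable_smul' hNm hfin).2 (hh.congr hsmul.symm)
  have hwi' : Integrable w (ν.map G) := by rw [hmap]; exact hwi
  have hofr : ∀ q, (ENNReal.ofReal |(fderiv ℝ G q).det|).toReal = |(fderiv ℝ G q).det| :=
    fun q => ENNReal.toReal_ofReal (abs_nonneg _)
  have hlt : ∀ᵐ q ∂μ, ENNReal.ofReal |(fderiv ℝ G q).det| < ⊤ :=
    Filter.Eventually.of_forall fun q => ENNReal.ofReal_lt_top
  constructor
  · have h1 := (integrable_map_measure hwi'.aestronglyMeasurable hGm.aemeasurable).1 hwi'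
    have h2 := (integrable_withDensity_iff_integrable_smul' hDm hlt).1 h1
    simp only [hofr] at h2
    exact h2
  · have h1 := integral_map hGm.aemeasurable hwi'.aestronglyMeasurable
    rw [hmap, integral_withDensity_eq_integral_toReal_smul hNm hfin, integral_congr_ae hsmul, hν,
      integral_withDensity_eq_integral_toReal_smul hDm hlt] at h1
    rw [h1]
    simp only [hofr, hw]

end AreaFormula

/-! ### Fourier inversion on `ℝᵏ ⊕ ℝˡ` with the kernel `e^{-i⟨·,·⟩}` -/

section Fourier

open FourierTransform

variable {k l : ℕ}

/-- The identification of the Euclidean space with `ℝᵏ ⊕ ℝˡ`. -/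
def euclideanProd (k l : ℕ) :
    EuclideanSpace ℝ (Fin k ⊕ Fin l) ≃L[ℝ] (Fin k → ℝ) × (Fin l → ℝ) :=
  (EuclideanSpace.equiv (Fin k ⊕ Fin l) ℝ).trans
    (ContinuousLinearEquiv.sumPiEquivProdPi ℝ (Fin k) (Fin l) fun _ => ℝ)

lemma measurePreserving_euclideanProd : MeasurePreserving (euclideanProd k l) :=
  (volume_measurePreserving_sumPiEquivProdPi fun _ : Fin k ⊕ Fin l => ℝ).comp
    (PiLp.volume_preserving_ofLp (Fin k ⊕ Fin l))

lemma inner_euclideanProd (v w : EuclideanSpace ℝ (Fin k ⊕ Fin l)) :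
    inner ℝ v w = (euclideanProd k l v).1 ⬝ᵥ (euclideanProd k l w).1 +
      (euclideanProd k l v).2 ⬝ᵥ (euclideanProd k l w).2 := by
  simp only [PiLp.inner_apply, Fintype.sum_sum_type, dotProduct]
  congr 1 <;> exact Finset.sum_congr rfl fun i _ => mul_comm _ _

lemma integral_comp_euclideanProd (g : (Fin k → ℝ) × (Fin l → ℝ) → ℂ) :
    ∫ v, g (euclideanProd k l v) = ∫ p, g p :=
  measurePreserving_euclideanProd.integral_comp
    (euclideanProd k l).toHomeomorph.measurableEmbedding g

/-- The Fourier transform `∫∫ f(x, y) e^{-i(⟨x, η⟩ + ⟨y, ξ⟩)} dx dy` on the Schwartz space. -/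
def prodFourier (f : 𝓢((Fin k → ℝ) × (Fin l → ℝ), ℂ)) : 𝓢((Fin k → ℝ) × (Fin l → ℝ), ℂ) :=
  -- `𝓕` has kernel `e^{-2πi⟨v, w⟩}` and lives on an inner product space; the frequency is therefore
  -- rescaled by `(2π)⁻¹` and moved to the Euclidean model.
  SchwartzMap.compCLMOfContinuousLinearEquiv ℂ ((euclideanProd k l).symm.trans
    (ContinuousLinearEquiv.smulLeft (Units.mk0 (2 * Real.pi)⁻¹ (by positivity))))
    (𝓕 (SchwartzMap.compCLMOfContinuousLinearEquiv ℂ (euclideanProd k l) f))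

lemma prodFourier_eq (f : 𝓢((Fin k → ℝ) × (Fin l → ℝ), ℂ)) (p : (Fin k → ℝ) × (Fin l → ℝ)) :
    prodFourier f p = 𝓕 (fun v => f (euclideanProd k l v))
      ((2 * Real.pi)⁻¹ • (euclideanProd k l).symm p) := rfl

lemma prodFourier_apply (f : 𝓢((Fin k → ℝ) × (Fin l → ℝ), ℂ)) (η : Fin k → ℝ)
    (ξ : Fin l → ℝ) :
    prodFourier f (η, ξ) = ∫ p, chr p.1 (-η) * chr p.2 (-ξ) * f p := by
  rw [prodFourier_eq, Real.fourier_eq',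
    ← integral_comp_euclideanProd fun p => chr p.1 (-η) * chr p.2 (-ξ) * f p]
  refine integral_congr_ae (Filter.Eventually.of_forall fun v => ?_)
  simp only [smul_eq_mul, inner_smul_right, inner_euclideanProd,
    ContinuousLinearEquiv.apply_symm_apply, chr, ← Complex.exp_add, dotProduct_neg]
  congr 2
  have : (Real.pi : ℂ) ≠ 0 := by exact_mod_cast Real.pi_ne_zero
  push_cast
  field_simp
  ring

/-- Fourier inversion. -/
lemma integral_prodFourier_mul (f : 𝓢((Fin k → ℝ) × (Fin l → ℝ), ℂ)) (x : Fin k → ℝ)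
    (y : Fin l → ℝ) :
    ∫ p, prodFourier f p * (chr x p.1 * chr y p.2) = (2 * Real.pi : ℝ) ^ (k + l) * f (x, y) := by
  set e := euclideanProd k l
  set f' := SchwartzMap.compCLMOfContinuousLinearEquiv ℂ e f
  have hinv : 𝓕⁻ (𝓕 (f' : EuclideanSpace ℝ (Fin k ⊕ Fin l) → ℂ)) (e.symm (x, y)) = f (x, y) := by
    rw [← SchwartzMap.fourier_coe, ← SchwartzMap.fourierInv_coe, fourierInv_fourier_eq]
    change f (e (e.symm (x, y))) = _
    rw [e.apply_symm_apply]
  rw [← hinv, Real.fourierInv_eq', ← integral_comp_euclideanProd]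
  -- Undoing the rescaling of the frequency by `2π` in dimension `k + l` produces the constant
  -- `(2π)^(k+l)`.
  have hs := Measure.integral_comp_inv_smul_of_nonneg
    (volume : Measure (EuclideanSpace ℝ (Fin k ⊕ Fin l)))
    (fun v => Complex.exp (↑(2 * Real.pi * inner ℝ v (e.symm (x, y))) * Complex.I) •
      𝓕 (f' : EuclideanSpace ℝ (Fin k ⊕ Fin l) → ℂ) v)
    (R := 2 * Real.pi) (by positivity)
  rw [finrank_euclideanSpace, Fintype.card_sum, Fintype.card_fin, Fintype.card_fin] at hs
  rw [← Complex.ofReal_pow, ← Complex.real_smul, ← hs]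
  refine integral_congr_ae (Filter.Eventually.of_forall fun v => ?_)
  simp only [prodFourier_eq]
  rw [ContinuousLinearEquiv.symm_apply_apply, smul_eq_mul, mul_comm]
  congr 1
  simp only [real_inner_smul_left, inner_euclideanProd, e,
    ContinuousLinearEquiv.apply_symm_apply, chr, ← Complex.exp_add,
    dotProduct_comm _ (euclideanProd k l v).1, dotProduct_comm _ (euclideanProd k l v).2]
  congr 1
  have : (Real.pi : ℂ) ≠ 0 := by exact_mod_cast Real.pi_ne_zero
  push_cast
  field_simp

end Fourier

/-! ### The conormal map: its fibres and its Jacobian -/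

section ConormalMap

variable {k l : ℕ}

lemma contDiff_vecMul_matAt (u : Matrix (Fin l) (Fin k) (MvPolynomial (Fin k) ℝ)) :
    ContDiff ℝ ∞ (fun q : (Fin l → ℝ) × (Fin k → ℝ) => q.1 ᵥ* matAt u q.2) := by
  refine contDiff_pi.2 fun j => ?_
  simp only [Matrix.vecMul, dotProduct, matAt, Matrix.map_apply]
  refine ContDiff.sum fun i _ => ContDiff.mul (by fun_prop) ?_
  exact (hasTemperateGrowth_eval (u i j)).1.comp contDiff_snd

/-- The map `(ξ, t) ↦ (ξ, -ξ u(t))`. -/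
def conormalMap (u : Matrix (Fin l) (Fin k) (MvPolynomial (Fin k) ℝ))
    (q : (Fin l → ℝ) × (Fin k → ℝ)) : (Fin l → ℝ) × (Fin k → ℝ) :=
  (q.1, -(q.1 ᵥ* matAt u q.2))

lemma contDiff_conormalMap (u : Matrix (Fin l) (Fin k) (MvPolynomial (Fin k) ℝ)) :
    ContDiff ℝ ∞ (conormalMap u) :=
  contDiff_fst.prodMk (contDiff_vecMul_matAt u).neg

/-- The map keeps `ξ`, so a fibre is a copy of the solution set in `t`. This makes the Crofton
function the multiplicity in the area formula. -/
lemma encard_preimage_conormalMap (u : Matrix (Fin l) (Fin k) (MvPolynomial (Fin k) ℝ))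
    (z : (Fin l → ℝ) × (Fin k → ℝ)) :
    (conormalMap u ⁻¹' {z}).encard = crofton u z.2 z.1 := by
  have : conormalMap u ⁻¹' {z} =
      (fun t => (z.1, t)) '' {t : Fin k → ℝ | z.2 = -(z.1 ᵥ* matAt u t)} := by
    ext ⟨ξ, t⟩
    simp only [conormalMap, Set.mem_preimage, Set.mem_singleton_iff, Set.mem_image,
      Set.mem_ofPred_eq, Prod.ext_iff]
    constructor
    · rintro ⟨h1, h2⟩
      exact ⟨t, by rw [← h2, h1], h1.symm, rfl⟩
    · rintro ⟨t', h, h1, rfl⟩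
      exact ⟨h1.symm, by rw [h, h1]⟩
  rw [this, (Prod.mk_right_injective z.1).encard_image, crofton]

/-- In the product basis the matrix is block lower triangular with an identity block, so only the
derivative in the second variable survives. -/
lemma det_fst_prod (D : (Fin l → ℝ) × (Fin k → ℝ) →L[ℝ] Fin k → ℝ) :
    ((ContinuousLinearMap.fst ℝ (Fin l → ℝ) (Fin k → ℝ)).prod D).det =
      (D.comp (ContinuousLinearMap.inr ℝ _ _)).det := by
  classical
  simp only [ContinuousLinearMap.det]
  rw [← LinearMap.det_toMatrix ((Pi.basisFun ℝ (Fin l)).prod (Pi.basisFun ℝ (Fin k))),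
    ← LinearMap.det_toMatrix (Pi.basisFun ℝ (Fin k))]
  rw [show LinearMap.toMatrix ((Pi.basisFun ℝ (Fin l)).prod (Pi.basisFun ℝ (Fin k)))
      ((Pi.basisFun ℝ (Fin l)).prod (Pi.basisFun ℝ (Fin k)))
      ((ContinuousLinearMap.fst ℝ (Fin l → ℝ) (Fin k → ℝ)).prod D : _ →L[ℝ] _).toLinearMap =
      Matrix.fromBlocks 1 0 (Matrix.of fun i j => D (Pi.single j 1, 0) i)
        (LinearMap.toMatrix (Pi.basisFun ℝ (Fin k)) (Pi.basisFun ℝ (Fin k))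
          (D.comp (ContinuousLinearMap.inr ℝ _ _)).toLinearMap) from ?_]
  · rw [Matrix.det_fromBlocks_zero₁₂, Matrix.det_one, one_mul]
  · ext (i | i) (j | j) <;>
      simp [LinearMap.toMatrix_apply, Matrix.one_apply, Pi.single_apply]

/-- The minus sign in the second component contributes `(-1)^k`, which the absolute value removes.
-/
lemma abs_det_fderiv_conormalMap (u : Matrix (Fin l) (Fin k) (MvPolynomial (Fin k) ℝ))
    (q : (Fin l → ℝ) × (Fin k → ℝ)) :
    |(fderiv ℝ (conormalMap u) q).det| = |jacobian u q.1 q.2| := by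
  have hd := ((contDiff_vecMul_matAt u).differentiable (by simp) q).hasFDerivAt
  have h1 : HasFDerivAt (conormalMap u) _ q := hasFDerivAt_fst.prodMk hd.neg
  have h2 : HasFDerivAt (fun τ : Fin k → ℝ => q.1 ᵥ* matAt u τ) _ q.2 :=
    HasFDerivAt.comp q.2 (g := fun q : (Fin l → ℝ) × (Fin k → ℝ) => q.1 ᵥ* matAt u q.2)
      (f := fun τ => (q.1, τ)) hd (hasFDerivAt_prodMk_right q.1 q.2)
  rw [h1.fderiv, det_fst_prod, jacobian, h2.fderiv, ContinuousLinearMap.neg_comp,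
    ContinuousLinearMap.det, ContinuousLinearMap.toLinearMap_neg, ← neg_one_smul ℝ,
    LinearMap.det_smul, abs_mul]
  simp [ContinuousLinearMap.det]

end ConormalMap

/-! ### The slice theorem for `J_a` and the inversion formula -/

section Inversion

variable {k l : ℕ}

instance isAddHaarMeasure_volume_prod :
    (volume : Measure ((Fin k → ℝ) × (Fin l → ℝ))).IsAddHaarMeasure :=
  Measure.prod.instIsAddHaarMeasure volume volume

/-- By the adjunction `⟨Mx, ξ⟩ = ⟨x, ξM⟩`. The double negation is kept so that the last two factors
are literally the kernel of `prodFourier` at the frequency `(-ξM, ξ)`. -/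
lemma chr_sub_mulVec_sub (M : Matrix (Fin l) (Fin k) ℝ) (x : Fin k → ℝ) (y s ξ : Fin l → ℝ) :
    chr (y - M *ᵥ x - s) (-ξ) = chr s ξ * (chr x (- -(ξ ᵥ* M)) * chr y (-ξ)) := by
  have h : (M *ᵥ x) ⬝ᵥ ξ = x ⬝ᵥ (ξ ᵥ* M) := by
    rw [dotProduct_comm, Matrix.dotProduct_mulVec, dotProduct_comm]
  simp only [chr, ← Complex.exp_add, sub_dotProduct, dotProduct_neg, neg_neg, h]
  congr 1
  push_cast
  ring

lemma chr_sub_mulVec (M : Matrix (Fin l) (Fin k) ℝ) (x : Fin k → ℝ) (y ξ : Fin l → ℝ) :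
    chr (y - M *ᵥ x) ξ = chr x (-(ξ ᵥ* M)) * chr y ξ := by
  have h := chr_sub_mulVec_sub M x y 0 (-ξ)
  have h0 : chr 0 (-ξ) = 1 := by simp [chr]
  rwa [sub_zero, neg_neg, Matrix.neg_vecMul, neg_neg, h0, one_mul] at h

/-- The reflection `(ξ, t) ↦ (-ξ, t)`. -/
def negFst (k l : ℕ) : (Fin l → ℝ) × (Fin k → ℝ) ≃ₜ (Fin l → ℝ) × (Fin k → ℝ) :=
  (Homeomorph.neg (Fin l → ℝ)).prodCongr (Homeomorph.refl (Fin k → ℝ))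

lemma negFst_apply (q : (Fin l → ℝ) × (Fin k → ℝ)) : negFst k l q = (-q.1, q.2) := rfl

lemma contDiff_negFst : ContDiff ℝ ∞ (negFst k l) := by
  change ContDiff ℝ ∞ fun q : (Fin l → ℝ) × (Fin k → ℝ) => (-q.1, q.2)
  fun_prop

lemma measurePreserving_negFst : MeasurePreserving (negFst k l) :=
  (Measure.measurePreserving_neg (volume : Measure (Fin l → ℝ))).prod
    (MeasurePreserving.id (volume : Measure (Fin k → ℝ)))

lemma locallyIntegrable_comp_negFst {g : (Fin l → ℝ) × (Fin k → ℝ) → ℂ}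
    (hg : LocallyIntegrable g) : LocallyIntegrable (g ∘ negFst k l) := by
  rw [locallyIntegrable_iff] at hg ⊢
  intro K hK
  have h := (measurePreserving_negFst.integrableOn_comp_preimage
    (negFst k l).measurableEmbedding).2 (hg _ (hK.image (negFst k l).continuous))
  rwa [Set.preimage_image_eq _ (negFst k l).injective] at h

/-- The Fourier transform of `f` restricted to the conormals `(-ξ u(t), ξ)`. -/
def conormalFourier (u : Matrix (Fin l) (Fin k) (MvPolynomial (Fin k) ℝ))
    (f : 𝓢((Fin k → ℝ) × (Fin l → ℝ), ℂ)) (q : (Fin l → ℝ) × (Fin k → ℝ)) : ℂ :=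
  prodFourier f (conormalMap u q).swap

lemma contDiff_conormalFourier (u : Matrix (Fin l) (Fin k) (MvPolynomial (Fin k) ℝ))
    (f : 𝓢((Fin k → ℝ) × (Fin l → ℝ), ℂ)) : ContDiff ℝ ∞ (conormalFourier u f) :=
  ((prodFourier f).smooth ⊤).comp
    ((contDiff_snd.prodMk contDiff_fst).comp (contDiff_conormalMap u))

lemma conormalFourier_apply (u : Matrix (Fin l) (Fin k) (MvPolynomial (Fin k) ℝ))
    (f : 𝓢((Fin k → ℝ) × (Fin l → ℝ), ℂ)) (ξ : Fin l → ℝ) (t : Fin k → ℝ) :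
    conormalFourier u f (ξ, t) =
      ∫ p, chr p.1 (- -(ξ ᵥ* matAt u t)) * chr p.2 (-ξ) * f p :=
  prodFourier_apply f _ _

/-- The Fourier slice theorem for the operator `transpose`. -/
lemma transpose_partialFourier_apply (u : Matrix (Fin l) (Fin k) (MvPolynomial (Fin k) ℝ))
    (f : 𝓢((Fin k → ℝ) × (Fin l → ℝ), ℂ)) (ψ : 𝓢((Fin l → ℝ) × (Fin k → ℝ), ℂ))
    (s : Fin l → ℝ) (t : Fin k → ℝ) :
    transpose u f (partialFourier ψ) (s, t) =
      ∫ ξ : Fin l → ℝ, chr s ξ * (ψ (negFst k l (ξ, t)) * conormalFourier u f (ξ, t)) := by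
  set β : (Fin k → ℝ) × (Fin l → ℝ) → Fin l → ℝ := fun p => p.2 - matAt u t *ᵥ p.1 - s with hβ
  have hβc : Continuous β := by
    have : Continuous fun p : (Fin k → ℝ) × (Fin l → ℝ) => matAt u t *ᵥ p.1 :=
      Continuous.matrix_mulVec continuous_const continuous_fst
    exact (continuous_snd.sub this).sub continuous_const
  have hψ : Integrable fun ξ : Fin l → ℝ => ψ (ξ, t) := by
    simpa [chr] using slice_integrable ψ 0 t
  -- Characters have modulus one and `f`, `ψ(·, t)` are integrable, so Fubini applies to the `p` and
  -- `ξ` integrals.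
  have hprod : Integrable (fun z : ((Fin k → ℝ) × (Fin l → ℝ)) × (Fin l → ℝ) =>
      chr (β z.1) z.2 * (f z.1 * ψ (z.2, t))) (volume.prod volume) :=
    (Integrable.mul_prod f.integrable hψ).bdd_mul (c := 1)
      (continuous_chr.comp (by fun_prop : Continuous fun z :
        ((Fin k → ℝ) × (Fin l → ℝ)) × (Fin l → ℝ) => (β z.1, z.2))).aestronglyMeasurable
      (Filter.Eventually.of_forall fun z => (norm_chr _ _).le)
  have hinner : ∀ p, f p * partialFourier ψ (β p, t) =
      ∫ ξ : Fin l → ℝ, chr (β p) ξ * (f p * ψ (ξ, t)) := fun p => by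
    rw [partialFourier_apply, ← integral_const_mul]
    refine integral_congr_ae (Filter.Eventually.of_forall fun ξ => ?_)
    simp only; ring
  have hint : Integrable fun p => f p * partialFourier ψ (β p, t) := by
    simp only [hinner]
    exact hprod.integral_prod_left
  calc transpose u f (partialFourier ψ) (s, t)
      = ∫ p, f p * partialFourier ψ (β p, t) := by
        rw [transpose_apply]
        exact (integral_prod_symm _ hint).symm
    _ = ∫ ξ : Fin l → ℝ, ∫ p, chr (β p) ξ * (f p * ψ (ξ, t)) := by
        simp only [hinner]
        exact integral_integral_swap hprod
    -- After `ξ ↦ -ξ` the inner integral over `p` is the Fourier transform of `f` at the conormal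
    -- `(-ξu(t), ξ)`, while `ψ` is evaluated at `(-ξ, t)`.
    _ = ∫ ξ : Fin l → ℝ, ∫ p, chr (β p) (-ξ) * (f p * ψ (-ξ, t)) :=
        (integral_neg_eq_self (fun ξ : Fin l → ℝ => ∫ p, chr (β p) ξ * (f p * ψ (ξ, t)))
          volume).symm
    _ = _ := by
        refine integral_congr_ae (Filter.Eventually.of_forall fun ξ => ?_)
        simp only [conormalFourier_apply, negFst_apply]
        rw [← mul_assoc, ← integral_const_mul]
        refine integral_congr_ae (Filter.Eventually.of_forall fun p => ?_)
        simp only [hβ, chr_sub_mulVec_sub]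
        ring

/-- The partial Fourier transform of `J_a f`. -/
lemma hasPartialFourier_transform {u : Matrix (Fin l) (Fin k) (MvPolynomial (Fin k) ℝ)}
    {a : 𝓢'((Fin l → ℝ) × (Fin k → ℝ), ℂ)} {aHat : (Fin l → ℝ) × (Fin k → ℝ) → ℂ}
    (ha : HasPartialFourier a aHat) (f : 𝓢((Fin k → ℝ) × (Fin l → ℝ), ℂ)) :
    HasPartialFourier (transform u a f)
      ((fun q => aHat q * conormalFourier u f q) ∘ negFst k l) := by
  refine ⟨locallyIntegrable_comp_negFst ?_, fun ψ hψ => ?_⟩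
  · rw [locallyIntegrable_iff]
    exact fun K hK => ((locallyIntegrable_iff.1 ha.1) K hK).mul_continuousOn
      (contDiff_conormalFourier u f).continuous.continuousOn hK
  -- The compact support of `ψ` makes this product a Schwartz function without any growth estimate
  -- on `conormalFourier`, and an admissible test function for `ha`.
  have hc : HasCompactSupport fun q => ψ (negFst k l q) * conormalFourier u f q :=
    HasCompactSupport.mul_right (f := fun q => ψ (negFst k l q))
      (hψ.comp_homeomorph (negFst k l))
  have hs : ContDiff ℝ ∞ fun q => ψ (negFst k l q) * conormalFourier u f q :=
    ((ψ.smooth ⊤).comp contDiff_negFst).mul (contDiff_conormalFourier u f)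
  set χ := hc.toSchwartzMap hs
  have hχ : ∀ q, χ q = ψ (negFst k l q) * conormalFourier u f q := fun _ => rfl
  -- The slice theorem turns `transpose` into a multiplication on the Fourier side, so the pairing
  -- with `a` reduces to the defining property of `aHat`.
  have he : transpose u f (partialFourier ψ) = partialFourier χ := by
    ext ⟨s, t⟩
    rw [transpose_partialFourier_apply, partialFourier_apply]
    simp only [hχ]
  have hσ : ∀ q, negFst k l (negFst k l q) = q := fun q => by simp [negFst_apply]
  calc transform u a f (partialFourier ψ) = ∫ q, aHat q * χ q := by
        rw [transform_apply, he, ha.2 χ hc]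
    _ = ∫ q, aHat (negFst k l q) * χ (negFst k l q) :=
        (measurePreserving_negFst.integral_comp (negFst k l).measurableEmbedding
          fun q => aHat q * χ q).symm
    _ = _ := by
        refine integral_congr_ae (Filter.Eventually.of_forall fun q => ?_)
        simp only [hχ, hσ, Function.comp_apply]
        ring

/-- The inversion formula in the sense of generalized functions. -/
theorem hasKernelIntegral_transform {u : Matrix (Fin l) (Fin k) (MvPolynomial (Fin k) ℝ)}
    (hCr : ∀ᵐ p : (Fin k → ℝ) × (Fin l → ℝ), crofton u p.1 p.2 ≠ 0 ∧ crofton u p.1 p.2 ≠ ⊤)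
    {a : 𝓢'((Fin l → ℝ) × (Fin k → ℝ), ℂ)} {aHat : (Fin l → ℝ) × (Fin k → ℝ) → ℂ}
    (ha : HasPartialFourier a aHat) (hne : ∀ᵐ q : (Fin l → ℝ) × (Fin k → ℝ), aHat q ≠ 0)
    (f : 𝓢((Fin k → ℝ) × (Fin l → ℝ), ℂ)) (x : Fin k → ℝ) (y : Fin l → ℝ) :
    HasKernelIntegral (transform u a f) (inverseDensity u aHat)
      (fun t => y - matAt u t *ᵥ x) (f (x, y)) := by
  set c : ℂ := ((2 * Real.pi : ℝ) ^ (k + l) : ℂ) with hc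
  have hc0 : c ≠ 0 := by
    have : (Real.pi : ℂ) ≠ 0 := by exact_mod_cast Real.pi_ne_zero
    simp [hc, this]
  -- `conormalMap` takes values in the order `(ξ, η)`, whereas `crofton` and `prodFourier` use `(η,
  -- ξ)`.
  have hswap : MeasurePreserving
      (Prod.swap : (Fin l → ℝ) × (Fin k → ℝ) → (Fin k → ℝ) × (Fin l → ℝ)) :=
    Measure.measurePreserving_swap
  have hN : ∀ᵐ z : (Fin l → ℝ) × (Fin k → ℝ), (conormalMap u ⁻¹' {z}).encard ≠ 0 ∧
      (conormalMap u ⁻¹' {z}).encard ≠ ⊤ := by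
    simp only [encard_preimage_conormalMap]
    exact hswap.quasiMeasurePreserving.ae hCr
  set h₀ : (Fin k → ℝ) × (Fin l → ℝ) → ℂ := fun p => prodFourier f p * (chr x p.1 * chr y p.2)
  have hh₀ : Integrable h₀ := by
    refine (prodFourier f).integrable.mul_bdd (c := 1) ?_ (Filter.Eventually.of_forall fun p => ?_)
    · exact ((continuous_chr.comp (by fun_prop : Continuous
        fun p : (Fin k → ℝ) × (Fin l → ℝ) => (x, p.1))).mul (continuous_chr.comp (by fun_prop :
        Continuous fun p : (Fin k → ℝ) × (Fin l → ℝ) => (y, p.2)))).aestronglyMeasurable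
    · rw [norm_mul, norm_chr, norm_chr, one_mul]
  have hh : Integrable (h₀ ∘ Prod.swap) := hswap.integrable_comp_of_integrable hh₀
  obtain ⟨hint, hval⟩ := integral_abs_det_smul_comp volume
    ((contDiff_conormalMap u).differentiable (by simp)) hN hh
  have hval' : ∫ z, (h₀ ∘ Prod.swap) z = c * f (x, y) := by
    rw [← integral_prodFourier_mul f x y]
    exact hswap.integral_comp MeasurableEquiv.prodComm.measurableEmbedding h₀
  -- Where `aHat` is nonzero it cancels against the denominator of the density, and the character at
  -- `y - u(t)x` splits into the inversion kernel at the conormal. The kernel integrand is thus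
  -- `c⁻¹` times the area formula integrand for `h₀`.
  have hae : (fun q : (Fin l → ℝ) × (Fin k → ℝ) => c⁻¹ * (|(fderiv ℝ (conormalMap u) q).det| •
      ((conormalMap u ⁻¹' {conormalMap u q}).encard.toNat : ℝ)⁻¹ •
        (h₀ ∘ Prod.swap) (conormalMap u q))) =ᵐ[volume]
      fun q => inverseDensity u aHat q *
        ((fun q => aHat q * conormalFourier u f q) ∘ negFst k l) (-q.1, q.2) *
        chr (y - matAt u q.2 *ᵥ x) q.1 := by
    filter_upwards [hne] with q hq
    have hσ : negFst k l (-q.1, q.2) = q := by simp [negFst_apply]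
    rw [Function.comp_apply (f := fun q => aHat q * conormalFourier u f q), hσ, chr_sub_mulVec,
      abs_det_fderiv_conormalMap, encard_preimage_conormalMap, inverseDensity, ← hc]
    change c⁻¹ * (_ • (_ : ℝ)⁻¹ • (conormalFourier u f q *
      (chr x (-(q.1 ᵥ* matAt u q.2)) * chr y q.1))) = _
    simp only [conormalMap, Complex.real_smul, div_eq_mul_inv, mul_inv]
    push_cast
    field_simp
  refine ⟨_, hasPartialFourier_transform ha f, (hint.const_mul c⁻¹).congr hae, ?_⟩
  rw [← integral_congr_ae hae, integral_const_mul, hval, hval', inv_mul_cancel_left₀ hc0]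

end Inversion

end PlaneComplex

end

theorem mainTheorem2 (k l : ℕ)
    (u : Matrix (Fin l) (Fin k) (MvPolynomial (Fin k) ℝ))
    (hCr : ∀ᵐ p : (Fin k → ℝ) × (Fin l → ℝ),
      PlaneComplex.crofton u p.1 p.2 ≠ 0 ∧ PlaneComplex.crofton u p.1 p.2 ≠ ⊤)
    (a : 𝓢'((Fin l → ℝ) × (Fin k → ℝ), ℂ))
    (aHat : (Fin l → ℝ) × (Fin k → ℝ) → ℂ)
    (ha : PlaneComplex.HasPartialFourier a aHat)
    (hne : ∀ᵐ q : (Fin l → ℝ) × (Fin k → ℝ), aHat q ≠ 0)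
    (f : 𝓢((Fin k → ℝ) × (Fin l → ℝ), ℂ)) (x : Fin k → ℝ) (y : Fin l → ℝ) :
    PlaneComplex.HasKernelIntegral (PlaneComplex.transform u a f)
      (PlaneComplex.inverseDensity u aHat)
      (fun t => y - PlaneComplex.matAt u t *ᵥ x) (f (x, y)) ∧
    ∀ φ : (Fin l → ℝ) × (Fin k → ℝ) → ℂ,
      (∀ ψ, PlaneComplex.transform u a f ψ = ∫ q, φ q * ψ q) →
      (∀ C : Set (Fin k → ℝ), IsCompact C → IntegrableOn φ (Set.univ ×ˢ C)) →
      (∀ᵐ t : Fin k → ℝ, Integrable fun ξ => PlaneComplex.inverseDensity u aHat (ξ, t)) →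
      f (x, y) = ∫ t : Fin k → ℝ, ∫ α : Fin l → ℝ,
        φ (α, t) * PlaneComplex.inverseKernel u aHat (y - PlaneComplex.matAt u t *ᵥ x - α) t := by
  have h := PlaneComplex.hasKernelIntegral_transform hCr ha hne f x y
  -- `inverseKernel` unfolds to the inner `ξ` integral of `HasKernelIntegral.eq_integral`.
  exact ⟨h, fun φ hφ hint hb => h.eq_integral hint hφ hb⟩
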